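/- **Model.** A frame has $N_{\mathrm s}$ slots and $K$ users. Each user is active with probability $\pi\in(0,1]$, independently of the others, so the number $K_{\mathrm a}$ of active users has mean $\mathbb E[K_{\mathrm a}]=\pi K$ (for $\pi=1$, $K_{\mathrm a}=K$ is fixed). Each active user independently draws a repetition degree $D\in\{1,\dots,d_{\max}\}$ with $\mathbb P(D=d)=\Lambda_d$, $\Lambda(x)=\sum_d\Lambda_dx^d$, and transmits a replica of its packet in $D$ slots chosen uniformly at random without replacement. Let $\bar d=\sum_d d\Lambda_d=\Lambda'(1)$. The users and slots form a bipartite graph with an edge $(u,s)$ whenever user $u$ transmits in slot $s$. The slot decoder succeeds on $t$ residual packets, $1\le t\le T$, with probability $1-P_{\mathrm E|t}$, where $P_{\mathrm E|t}\in[0,1]$ and $P_{\mathrm E|1}\le\dots\le P_{\mathrm E|T}$; it never decodes more than $T$ packets. The outcome for each $t$ is determined by the noise in the slot and is the same in all iterations, and a slot that is decodable with $t+1$ residual packets is decodable with $t$: slot $s$ is decodable with $t\ge 1$ residual packets iff $t\le\kappa_s$, where the $\kappa_s\in\{0,\dots,T\}$ are i.i.d. over the slots, independent of the graph, with $\mathbb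 P(\kappa_s<t)=P_{\mathrm E|t}$ for $1\le t\le T$. Interference cancellation is ideal. Successive interference cancellation (SIC) is the following message passing on the graph. At iteration $0$ every user is undetected along each of its edges. At each iteration $\ell\ge0$, slot $s$ is resolved along its edge to $u$ iff the number of residual packets, counting that of $u$ and those of the other users of $s$ that are undetected along their edge to $s$, is at most $\kappa_s$. At iteration $\ell\ge1$, user $u$ is undetected along its edge to $s$ iff every other slot used by $u$ was unresolved along its edge to $u$ at iteration $\ell-1$. Let $p_\ell$ (respectively $q_\ell$) denote the limit of the conditional probability, given that $(u,s)$ is an edge, that at iteration $\ell$ slot $s$ is unresolved along $(u,s)$ (respectively user $u$ is undetected along $(u,s)$). **Theorem.** Fix $\Lambda$, $T$, $(P_{\mathrm E|t})_{1\le t\le T}$, $\pi\in(0,1]$ and $\mathsf G>0$, and let $N_{\mathrm s}\to\infty$ and $K\to\infty$ with $\mathbb E[K_{\mathrm a}]/N_{\mathrm s}=\pi K/N_{\mathrm s}\to\mathsf G$. Then for every $\ell\ge0$ the limits $p_\ell$ and $q_\ell$ exist, uniformly over all pairs $(u,s)$; moreover $q_0=1$, $$p_0=1-e^{-\mathsf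 G\bar d}\sum_{t=1}^{T}(1-P_{\mathrm E|t})\frac{(\mathsf G\bar d)^{t-1}}{(t-1)!},$$ and for every $\ell\ge1$ $$q_\ell=\frac1{\bar d}\sum_d\Lambda_d\,d\,p_{\ell-1}^{\,d-1}=\frac{\Lambda'(p_{\ell-1})}{\bar d},\qquad p_\ell=1-e^{-\mathsf G\bar dq_\ell}\sum_{t=1}^{T}(1-P_{\mathrm E|t})\frac{(\mathsf G\bar dq_\ell)^{t-1}}{(t-1)!}.$$ In the special case $T=1$, $p_0=1-(1-P_{\mathrm E|1})e^{-\mathsf G\bar d}$ and $p_\ell=1-(1-P_{\mathrm E|1})e^{-\mathsf G\bar dq_\ell}$ for $\ell\ge1$. -/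

import Mathlib

namespace IRSA

open Finset Polynomial
open scoped Nat

/-- A realization of one frame with `K` users, `N` slots and a slot decoder of multi-packet
reception capability `T`. The first component gives, for every user, the set of slots in which it
transmits a replica (empty for an idle user), i.e. the bipartite user-slot graph. The second one
gives, for every slot, the largest number of residual packets that the slot decoder is able to
decode under the noise of that slot. -/
abbrev Config (K N T : ℕ) : Type := (Fin K → Finset (Fin N)) × (Fin N → Fin (T + 1))

section Law

/-- Probability that a user transmits exactly in the slots of `A`: it is active with probability
`π`; an active user draws a degree `d` with probability `Λ_d = Λ.coeff d`, then `d` of the `N`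
slots uniformly without replacement. -/
noncomputable def userWeight {N : ℕ} (Λ : ℝ[X]) (π : ℝ) (A : Finset (Fin N)) : ℝ :=
  if A = ∅ then 1 - π else π * (Λ.coeff A.card / (N.choose A.card : ℝ))

/-- Probability that the slot decoder succeeds on `t` residual packets: `1 - P_{E|t}` for
`1 ≤ t ≤ T`, an empty slot is always resolved, more than `T` packets are never decoded. -/
noncomputable def successProb (T : ℕ) (PE : ℕ → ℝ) (t : ℕ) : ℝ :=
  if t = 0 then 1 else if t ≤ T then 1 - PE t else 0

/-- Law of the number of packets that a slot decoder can handle: the value is at least `t` with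
probability `successProb T PE t`. -/
noncomputable def slotWeight {T : ℕ} (PE : ℕ → ℝ) (c : Fin (T + 1)) : ℝ :=
  successProb T PE c - successProb T PE (c + 1)

open Classical in
/-- Probability of an event: users are independent and identically distributed, so are the slot
decoders, and the users are independent of the slot decoders. -/
noncomputable def prob {K N T : ℕ} (Λ : ℝ[X]) (π : ℝ) (PE : ℕ → ℝ)
    (E : Config K N T → Prop) : ℝ :=
  ∑ ω : Config K N T, if E ω then
    (∏ u, userWeight Λ π (ω.1 u)) * ∏ s, slotWeight PE (ω.2 s) else 0

/-- Conditional probability of `E` given that `(u, s)` is an edge of the graph. -/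
noncomputable def edgeProb {K N T : ℕ} (Λ : ℝ[X]) (π : ℝ) (PE : ℕ → ℝ)
    (E : Config K N T → Prop) (u : Fin K) (s : Fin N) : ℝ :=
  prob Λ π PE (fun ω => s ∈ ω.1 u ∧ E ω) / prob Λ π PE (fun ω : Config K N T => s ∈ ω.1 u)

/-- The mean repetition degree `d̄ = Λ'(1)`. -/
noncomputable def meanDegree (Λ : ℝ[X]) : ℝ := (derivative Λ).eval 1

end Law

section MessagePassing

variable {K N T : ℕ}

open Classical in
/-- Number of packets left in slot `s` as seen along its edge to user `u`, when `m v s` means that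
user `v` is not yet detected as seen along its edge to `s`: the packet of `u` itself, plus those of
the other users of the slot that are not yet detected. -/
noncomputable def residual (ω : Config K N T) (m : Fin K → Fin N → Prop) (s : Fin N)
    (u : Fin K) : ℕ :=
  (univ.filter fun v => v ≠ u ∧ s ∈ ω.1 v ∧ m v s).card + 1

/-- SIC as message passing, user-to-slot messages: `userUndetected ω ℓ u s` says that, at
iteration `ℓ`, user `u` is not yet detected as seen along its edge to slot `s`. No user is detected
at iteration `0`; later on, `u` is undetected along the edge to `s` as long as the slot decoder has
failed, at the previous iteration, in all the other slots used by `u`. -/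
def userUndetected (ω : Config K N T) : ℕ → Fin K → Fin N → Prop
  | 0, _, _ => True
  | ℓ + 1, u, s => ∀ s' ∈ ω.1 u, s' ≠ s →
      (ω.2 s' : ℕ) < residual ω (userUndetected ω ℓ) s' u

/-- Slot-to-user messages: at the end of iteration `ℓ`, slot `s` is not yet resolved as seen along
its edge to user `u`. -/
def slotUnresolved (ω : Config K N T) (ℓ : ℕ) (s : Fin N) (u : Fin K) : Prop :=
  (ω.2 s : ℕ) < residual ω (userUndetected ω ℓ) s u

end MessagePassing

section SIC

variable {K N T : ℕ}

open Classical in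
/-- Number of packets left in slot `s` when the packets of the users outside `U` have been
cancelled. -/
noncomputable def remaining (ω : Config K N T) (U : Fin K → Prop) (s : Fin N) : ℕ :=
  (univ.filter fun v => s ∈ ω.1 v ∧ U v).card

/-- The SIC decoder itself: users not detected before the slot decoding attempts of iteration `ℓ`.
Whenever a slot is resolved, all its users are detected and cancelled everywhere. -/
def sicUndetected (ω : Config K N T) : ℕ → Fin K → Prop
  | 0, _ => True
  | ℓ + 1, u => sicUndetected ω ℓ u ∧
      ∀ s ∈ ω.1 u, (ω.2 s : ℕ) < remaining ω (sicUndetected ω ℓ) s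

theorem residual_mono (ω : Config K N T) {m m' : Fin K → Fin N → Prop}
    (h : ∀ v s, m' v s → m v s) (s : Fin N) (u : Fin K) :
    residual ω m' s u ≤ residual ω m s u := by
  classical
  refine Nat.succ_le_succ (Finset.card_le_card fun v hv => ?_)
  simp only [Finset.mem_filter, Finset.mem_univ, true_and] at hv ⊢
  exact ⟨hv.1, hv.2.1, h v s hv.2.2⟩

theorem userUndetected_succ (ω : Config K N T) (ℓ : ℕ) (u : Fin K) (s : Fin N) :
    userUndetected ω (ℓ + 1) u s → userUndetected ω ℓ u s := by
  induction ℓ generalizing u s with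
  | zero => intro _; trivial
  | succ ℓ ih =>
    intro h s' hs' hne
    exact lt_of_lt_of_le (h s' hs' hne) (residual_mono ω ih s' u)

/-- A slot that has been resolved stays resolved. -/
theorem slotUnresolved_succ (ω : Config K N T) (ℓ : ℕ) (s : Fin N) (u : Fin K)
    (h : slotUnresolved ω (ℓ + 1) s u) : slotUnresolved ω ℓ s u :=
  lt_of_lt_of_le h (residual_mono ω (userUndetected_succ ω ℓ) s u)

theorem residual_eq (ω : Config K N T) (m : Fin K → Fin N → Prop) {s : Fin N} {u : Fin K}
    (hs : s ∈ ω.1 u) (hm : m u s) : residual ω m s u = remaining ω (fun v => m v s) s := by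
  classical
  unfold residual remaining
  rw [← Finset.card_insert_of_notMem (a := u) (by simp)]
  congr 1
  ext v
  by_cases h : v = u
  · subst h; simp [hs, hm]
  · simp [h]

theorem remaining_mono (ω : Config K N T) {U U' : Fin K → Prop} {s : Fin N}
    (h : ∀ v, s ∈ ω.1 v → U' v → U v) : remaining ω U' s ≤ remaining ω U s := by
  classical
  refine Finset.card_le_card fun v hv => ?_
  simp only [Finset.mem_filter, Finset.mem_univ, true_and] at hv ⊢
  exact ⟨hv.1, h v hv.1 hv.2⟩

/-- The message-passing description is the SIC decoder: after iteration `ℓ`, a user is undetected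
iff all the slots it uses are unresolved as seen along their edges to that user. -/
theorem sicUndetected_iff (ω : Config K N T) (ℓ : ℕ) (u : Fin K) :
    sicUndetected ω (ℓ + 1) u ↔ ∀ s ∈ ω.1 u, slotUnresolved ω ℓ s u := by
  induction ℓ generalizing u with
  | zero =>
    have key : ∀ s ∈ ω.1 u, residual ω (userUndetected ω 0) s u
        = remaining ω (sicUndetected ω 0) s := fun s hs => residual_eq ω _ hs trivial
    constructor
    · intro h s hs
      unfold slotUnresolved
      rw [key s hs]
      exact h.2 s hs
    · intro h
      refine ⟨trivial, fun s hs => ?_⟩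
      rw [← key s hs]
      exact h s hs
  | succ k ih =>
    have hA : ∀ v s, sicUndetected ω (k + 1) v → userUndetected ω (k + 1) v s :=
      fun v s hv s' hs' _ => (ih v).1 hv s' hs'
    constructor
    · intro h s hs
      unfold slotUnresolved
      rw [residual_eq ω _ hs (hA u s h.1)]
      exact lt_of_lt_of_le (h.2 s hs) (remaining_mono ω fun v _ hv => hA v s hv)
    · intro h
      have hk : ∀ s ∈ ω.1 u, slotUnresolved ω k s u :=
        fun s hs => slotUnresolved_succ ω k s u (h s hs)
      have hu : sicUndetected ω (k + 1) u := (ih u).2 hk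
      refine ⟨hu, fun s hs => ?_⟩
      have h1 := h s hs
      unfold slotUnresolved at h1
      rw [residual_eq ω _ hs (hA u s hu)] at h1
      refine lt_of_lt_of_le h1 (remaining_mono ω fun v hv hvm => (ih v).2 fun s' hs' => ?_)
      by_cases hss : s' = s
      · subst hss
        have h2 := hk s' hs
        unfold slotUnresolved at h2 ⊢
        rw [residual_eq ω _ hs (userUndetected_succ ω k u s' (hA u s' hu))] at h2
        rwa [residual_eq ω _ hv (userUndetected_succ ω k v s' hvm)]
      · exact hvm s' hs' hss

end SIC

end IRSA

/-! The proof is a cavity argument. Delete a user `v`: the remaining frame is independent of the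
slots chosen by `v`. As long as no self-avoiding exploration from a slot of `v` comes back
(`Returns`), the messages along the edges of `v` are determined exactly by which slots are blocked
in the frame without `v` (`userUndetected_del`, `residual_eq_pending_del`,
`userUndetected_iff_del`). A return at bounded depth has probability O(1/N) by a first-moment bound
(`Ex_returns_le`), because a user hits two prescribed slots with probability only O(1/N²).

Given its degree, the slot set of `v` is uniform. Hence the probability that `v` uses `s` while all
its other slots are blocked depends, up to O(1/N²), only on the fraction `X` of blocked slots: it is
π Λ'(X)/N (`touchWeight_approx`). After division by the edge probability π d̄/N this is the formula
for `q`.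

No limiting random tree is built. The number of pending users in a slot is identified by a
Stein-type identity. Counting pairs (pending user, event) gives (j+1) P(pending = j+1) = Σ_v P(v
pending, pending = j+1); removing `v` lowers the count by one, so the right side is close to (πK/N)
Λ'(x) P(pending = j) whenever `X` is close to `x` (`Setting.pending_recursion`). Together with
tightness this forces the Poisson law of parameter G Λ'(x) (`tendsto_poisson`), and a slot of
capability `c` blocks an additional user iff at least `c` users are pending. This is the formula for
`p`.

The induction on the iteration must also propagate that `X` is close to a constant. For this the
Poisson limit is proved jointly with the capability of the slot and weighted by a test function `Y`
that hardly depends on any single user. Averaging over slots, with a law of large numbers for the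
capabilities, yields E[XY] - x E[Y] → 0; the choices `Y = 1` and `Y = X` give E[(X - x)²] → 0
(`Setting.concentrates`).

Limits are taken along arbitrary filters with arbitrary choices of slots and users. Using the set of
all edges of all frames as index set then turns convergence into uniform convergence
(`eventually_forall_edge`). -/

namespace IRSA

open Finset Polynomial
open scoped Nat

/-! ### Expectation under independent users and slots; conditioning on and deleting one user. -/

section Expectation

open Classical in
/-- Indicator of a proposition, as a real number. -/
noncomputable def ind (p : Prop) : ℝ := if p then 1 else 0

theorem ind_of {p : Prop} (h : p) : ind p = 1 := by simp [ind, h]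

theorem ind_of_not {p : Prop} (h : ¬p) : ind p = 0 := by simp [ind, h]

theorem ind_nonneg (p : Prop) : 0 ≤ ind p := by unfold ind; split_ifs <;> norm_num

theorem ind_le_one (p : Prop) : ind p ≤ 1 := by unfold ind; split_ifs <;> norm_num

theorem ind_mono {p q : Prop} (h : p → q) : ind p ≤ ind q := by
  by_cases hp : p
  · rw [ind_of hp, ind_of (h hp)]
  · rw [ind_of_not hp]; exact ind_nonneg q

theorem ind_congr {p q : Prop} (h : p ↔ q) : ind p = ind q := by rw [propext h]

theorem ind_and (p q : Prop) : ind (p ∧ q) = ind p * ind q := by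
  by_cases hp : p <;> by_cases hq : q <;> simp [ind, hp, hq]

theorem ind_sub_ind_abs_le_one (p q : Prop) : |ind p - ind q| ≤ 1 := by
  rw [abs_le]
  constructor <;> linarith [ind_nonneg p, ind_nonneg q, ind_le_one p, ind_le_one q]

variable {K N T : ℕ}

/-- Expectation when the users are independent, user `u` having law `w u`, and the slot decoders
are i.i.d. -/
noncomputable def Ex (PE : ℕ → ℝ) (w : Fin K → Finset (Fin N) → ℝ) (f : Config K N T → ℝ) : ℝ :=
  ∑ ω : Config K N T, ((∏ u, w u (ω.1 u)) * ∏ s, slotWeight PE (ω.2 s)) * f ω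

/-- A probability distribution on sets of at most `D` slots. -/
structure IsUserLaw (D : ℕ) (ν : Finset (Fin N) → ℝ) : Prop where
  nonneg : ∀ A, 0 ≤ ν A
  sum_one : ∑ A, ν A = 1
  card_le : ∀ A, ν A ≠ 0 → A.card ≤ D

/-- The slot weights form a probability distribution. -/
structure IsSlotLaw (T : ℕ) (PE : ℕ → ℝ) : Prop where
  nonneg : ∀ c : Fin (T + 1), 0 ≤ slotWeight PE c
  sum_one : ∑ c : Fin (T + 1), slotWeight PE c = 1

theorem prob_eq_Ex (Λ : ℝ[X]) (π : ℝ) (PE : ℕ → ℝ) (E : Config K N T → Prop) :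
    prob Λ π PE E = Ex PE (fun _ => userWeight Λ π) (fun ω => ind (E ω)) := by
  unfold prob Ex ind
  refine Finset.sum_congr rfl fun ω _ => ?_
  by_cases h : E ω <;> simp [h]

variable {PE : ℕ → ℝ} {w : Fin K → Finset (Fin N) → ℝ} {D : ℕ}

theorem Ex_add (f g : Config K N T → ℝ) : Ex PE w (fun ω => f ω + g ω) = Ex PE w f + Ex PE w g := by
  simp [Ex, mul_add, Finset.sum_add_distrib]

theorem Ex_sub (f g : Config K N T → ℝ) : Ex PE w (fun ω => f ω - g ω) = Ex PE w f - Ex PE w g := by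
  simp [Ex, mul_sub, Finset.sum_sub_distrib]

theorem Ex_const_mul (a : ℝ) (f : Config K N T → ℝ) :
    Ex PE w (fun ω => a * f ω) = a * Ex PE w f := by
  simp only [Ex, Finset.mul_sum]
  exact Finset.sum_congr rfl fun ω _ => by ring

theorem Ex_sum {ι : Type*} (S : Finset ι) (f : ι → Config K N T → ℝ) :
    Ex PE w (fun ω => ∑ i ∈ S, f i ω) = ∑ i ∈ S, Ex PE w (f i) := by
  simp only [Ex, Finset.mul_sum]
  exact Finset.sum_comm

/-- Expectation of a product of functions of the single coordinates. -/
theorem Ex_prod (g : Fin K → Finset (Fin N) → ℝ) (h : Fin N → Fin (T + 1) → ℝ) :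
    Ex PE w (fun ω => (∏ u, g u (ω.1 u)) * ∏ s, h s (ω.2 s)) =
      (∏ u, ∑ A, w u A * g u A) * ∏ s, ∑ c, slotWeight PE c * h s c := by
  rw [Finset.prod_univ_sum, Finset.prod_univ_sum, Finset.sum_mul_sum]
  simp only [Fintype.piFinset_univ]
  unfold Ex
  rw [Fintype.sum_prod_type]
  refine Finset.sum_congr rfl fun a _ => Finset.sum_congr rfl fun b _ => ?_
  rw [Finset.prod_mul_distrib, Finset.prod_mul_distrib]
  ring

theorem Ex_one (hw : ∀ u, IsUserLaw D (w u)) (hs : IsSlotLaw T PE) :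
    Ex PE w (fun _ : Config K N T => 1) = 1 := by
  have := Ex_prod (PE := PE) (w := w) (T := T) (fun _ _ => 1) (fun _ _ => 1)
  simpa [(hw _).sum_one, hs.sum_one] using this

theorem Ex_const (hw : ∀ u, IsUserLaw D (w u)) (hs : IsSlotLaw T PE) (a : ℝ) :
    Ex PE w (fun _ : Config K N T => a) = a := by
  have := Ex_const_mul (PE := PE) (w := w) (T := T) a (fun _ => 1)
  rw [Ex_one hw hs] at this
  simpa using this

theorem weight_nonneg (hw : ∀ u, IsUserLaw D (w u)) (hs : IsSlotLaw T PE) (ω : Config K N T) :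
    0 ≤ (∏ u, w u (ω.1 u)) * ∏ s, slotWeight PE (ω.2 s) :=
  mul_nonneg (Finset.prod_nonneg fun u _ => (hw u).nonneg _)
    (Finset.prod_nonneg fun _ _ => hs.nonneg _)

/-- Monotonicity, with inequality required on the support only. -/
theorem Ex_mono_support (hw : ∀ u, IsUserLaw D (w u)) (hs : IsSlotLaw T PE)
    {f g : Config K N T → ℝ} (h : ∀ ω : Config K N T, (∀ u, w u (ω.1 u) ≠ 0) → f ω ≤ g ω) :
    Ex PE w f ≤ Ex PE w g := by
  refine Finset.sum_le_sum fun ω _ => ?_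
  by_cases hω : ∀ u, w u (ω.1 u) ≠ 0
  · exact mul_le_mul_of_nonneg_left (h ω hω) (weight_nonneg hw hs ω)
  · push Not at hω
    obtain ⟨u, hu⟩ := hω
    rw [Finset.prod_eq_zero (Finset.mem_univ u) hu]
    simp

theorem Ex_mono (hw : ∀ u, IsUserLaw D (w u)) (hs : IsSlotLaw T PE)
    {f g : Config K N T → ℝ} (h : ∀ ω, f ω ≤ g ω) : Ex PE w f ≤ Ex PE w g :=
  Ex_mono_support hw hs fun ω _ => h ω

theorem Ex_nonneg (hw : ∀ u, IsUserLaw D (w u)) (hs : IsSlotLaw T PE)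
    {f : Config K N T → ℝ} (h : ∀ ω, 0 ≤ f ω) : 0 ≤ Ex PE w f :=
  Finset.sum_nonneg fun ω _ => mul_nonneg (weight_nonneg hw hs ω) (h ω)

theorem Ex_le_const (hw : ∀ u, IsUserLaw D (w u)) (hs : IsSlotLaw T PE)
    {f : Config K N T → ℝ} {a : ℝ} (h : ∀ ω, f ω ≤ a) : Ex PE w f ≤ a :=
  (Ex_mono hw hs h).trans_eq (Ex_const hw hs a)

theorem abs_Ex_le (hw : ∀ u, IsUserLaw D (w u)) (hs : IsSlotLaw T PE)
    (f : Config K N T → ℝ) : |Ex PE w f| ≤ Ex PE w (fun ω => |f ω|) := by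
  refine (Finset.abs_sum_le_sum_abs _ _).trans (Finset.sum_le_sum fun ω _ => ?_)
  rw [abs_mul, abs_of_nonneg (weight_nonneg hw hs ω)]

theorem abs_Ex_sub_le (hw : ∀ u, IsUserLaw D (w u)) (hs : IsSlotLaw T PE)
    (f g : Config K N T → ℝ) : |Ex PE w f - Ex PE w g| ≤ Ex PE w (fun ω => |f ω - g ω|) := by
  rw [← Ex_sub]
  exact abs_Ex_le hw hs _

/-- The variance of `|f|` is nonnegative: expand the mean of `(|f| - m)²`. It turns second-moment
estimates into L¹ estimates. -/
theorem Ex_abs_sq_le (hw : ∀ u, IsUserLaw D (w u)) (hs : IsSlotLaw T PE)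
    (f : Config K N T → ℝ) : Ex PE w (fun ω => |f ω|) ^ 2 ≤ Ex PE w (fun ω => f ω ^ 2) := by
  set m := Ex PE w (fun ω => |f ω|) with hm
  have h0 : 0 ≤ Ex PE w (fun ω => f ω ^ 2 - 2 * m * |f ω| + m ^ 2) :=
    Ex_nonneg hw hs fun ω => by
      have : f ω ^ 2 - 2 * m * |f ω| + m ^ 2 = (|f ω| - m) ^ 2 := by
        rw [sub_sq, sq_abs]; ring
      rw [this]; positivity
  rw [Ex_add (fun ω => f ω ^ 2 - 2 * m * |f ω|) (fun _ => m ^ 2),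
    Ex_sub (fun ω => f ω ^ 2) (fun ω => 2 * m * |f ω|), Ex_const_mul, Ex_const hw hs, ← hm] at h0
  nlinarith

/-- Point mass at a set of slots. -/
noncomputable def dirac (A : Finset (Fin N)) : Finset (Fin N) → ℝ := Pi.single A 1

theorem dirac_isUserLaw {A : Finset (Fin N)} (hA : A.card ≤ D) : IsUserLaw D (dirac A) where
  nonneg B := by unfold dirac; rw [Pi.single_apply]; split_ifs <;> norm_num
  sum_one := by simp [dirac]
  card_le B hB := by
    by_cases h : B = A
    · rwa [h]
    · simp [dirac, h] at hB

theorem update_isUserLaw (hw : ∀ u, IsUserLaw D (w u)) (v : Fin K) {ν : Finset (Fin N) → ℝ}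
    (hν : IsUserLaw D ν) (u : Fin K) : IsUserLaw D (Function.update w v ν u) := by
  by_cases h : u = v
  · subst h; simpa using hν
  · simpa [h] using hw u

theorem prod_update_law (v : Fin K) (ν : Finset (Fin N) → ℝ) (x : Fin K → Finset (Fin N)) :
    ∏ u, Function.update w v ν u (x u) = ν (x v) * ∏ u ∈ univ.erase v, w u (x u) := by
  rw [← Finset.mul_prod_erase univ _ (Finset.mem_univ v), Function.update_self]
  congr 1
  refine Finset.prod_congr rfl fun u hu => ?_
  rw [Function.update_of_ne (Finset.ne_of_mem_erase hu)]

/-- Conditioning on the set of slots of one user. -/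
theorem Ex_cond (v : Fin K) (f : Config K N T → ℝ) :
    Ex PE w f = ∑ A, w v A * Ex PE (Function.update w v (dirac A)) f := by
  simp only [Ex, Finset.mul_sum]
  rw [Finset.sum_comm]
  refine Finset.sum_congr rfl fun ω _ => ?_
  simp only [prod_update_law]
  rw [Finset.sum_eq_single (ω.1 v)]
  · rw [← Finset.mul_prod_erase univ _ (Finset.mem_univ v)]
    simp [dirac]
    ring
  · intro A _ hA
    simp [dirac, hA.symm]
  · simp

theorem Ex_cond_update (v : Fin K) (ν : Finset (Fin N) → ℝ) (f : Config K N T → ℝ) :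
    Ex PE (Function.update w v ν) f = ∑ A, ν A * Ex PE (Function.update w v (dirac A)) f := by
  rw [Ex_cond v]
  simp

theorem Ex_dirac_congr (v : Fin K) (A : Finset (Fin N)) {f g : Config K N T → ℝ}
    (h : ∀ ω : Config K N T, ω.1 v = A → f ω = g ω) :
    Ex PE (Function.update w v (dirac A)) f = Ex PE (Function.update w v (dirac A)) g := by
  refine Finset.sum_congr rfl fun ω _ => ?_
  by_cases hω : ω.1 v = A
  · rw [h ω hω]
  · simp [prod_update_law, dirac, hω]

/-- The frame without the users of `W`. -/
def del (W : Finset (Fin K)) (ω : Config K N T) : Config K N T :=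
  (fun u => if u ∈ W then ∅ else ω.1 u, ω.2)

/-- Exchanging `A` and `B` in coordinate `v` is a bijection of configurations that matches the two
weights and is invisible after `v` is deleted. -/
theorem Ex_dirac_del (v : Fin K) (A B : Finset (Fin N)) (f : Config K N T → ℝ) :
    Ex PE (Function.update w v (dirac A)) (fun ω => f (del {v} ω)) =
      Ex PE (Function.update w v (dirac B)) (fun ω => f (del {v} ω)) := by
  let e : Config K N T ≃ Config K N T := Equiv.prodCongr
    (Equiv.piCongrRight fun u => if u = v then Equiv.swap A B else Equiv.refl _) (Equiv.refl _)
  have he1 : ∀ ω : Config K N T, (e ω).1 v = Equiv.swap A B (ω.1 v) := fun ω => by simp [e]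
  have he2 : ∀ (ω : Config K N T) u, u ≠ v → (e ω).1 u = ω.1 u := fun ω u hu => by simp [e, hu]
  refine Fintype.sum_equiv e _ _ fun ω => ?_
  have hdel : del {v} (e ω) = del {v} ω := by
    refine Prod.ext (funext fun u => ?_) rfl
    by_cases hu : u = v
    · simp [del, hu]
    · simp [del, hu, he2 ω u hu]
  have hd : (dirac B ((e ω).1 v) : ℝ) = dirac A (ω.1 v) := by
    rw [he1]
    simp only [dirac, Pi.single_apply]
    congr 1
    rw [Equiv.swap_apply_eq_iff, Equiv.swap_apply_right]
  simp only [hdel]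
  rw [prod_update_law, prod_update_law, hd]
  congr 3
  exact Finset.prod_congr rfl fun u hu => by rw [he2 ω u (Finset.ne_of_mem_erase hu)]

/-- The law of a deleted user is irrelevant. -/
theorem Ex_del {ν ν' : Finset (Fin N) → ℝ} (hν : IsUserLaw D ν) (hν' : IsUserLaw D ν')
    (v : Fin K) (f : Config K N T → ℝ) :
    Ex PE (Function.update w v ν) (fun ω => f (del {v} ω)) =
      Ex PE (Function.update w v ν') (fun ω => f (del {v} ω)) := by
  rw [Ex_cond_update, Ex_cond_update v ν']
  simp only [Ex_dirac_del v _ ∅ f]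
  rw [← Finset.sum_mul, ← Finset.sum_mul, hν.sum_one, hν'.sum_one]

theorem Ex_user (hw : ∀ u, IsUserLaw D (w u)) (hs : IsSlotLaw T PE) (v : Fin K)
    (g : Finset (Fin N) → ℝ) :
    Ex PE w (fun ω : Config K N T => g (ω.1 v)) = ∑ A, w v A * g A := by
  rw [Ex_cond v]
  refine Finset.sum_congr rfl fun A _ => ?_
  by_cases hA : w v A = 0
  · simp [hA]
  rw [Ex_dirac_congr v A (g := fun _ => g A) fun ω h => by rw [h],
    Ex_const (update_isUserLaw hw v (dirac_isUserLaw ((hw v).card_le A hA))) hs]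

end Expectation

/-! ### Locality of the messages: effect of deleting users. -/

section Locality

variable {K N T : ℕ}

open Classical in
/-- Number of users of slot `t` that are undetected as seen along their edge to `t`. -/
noncomputable def pending (ω : Config K N T) (ℓ : ℕ) (t : Fin N) : ℕ :=
  (univ.filter fun v => t ∈ ω.1 v ∧ userUndetected ω ℓ v t).card

open Classical in
/-- Slots that an additional user would see as unresolved at iteration `ℓ - 1` (all of them for
`ℓ = 0`). -/
noncomputable def blocked (ω : Config K N T) : ℕ → Finset (Fin N)
  | 0 => univ
  | ℓ + 1 => univ.filter fun t => (ω.2 t : ℕ) < pending ω ℓ t + 1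

/-- A self-avoiding exploration of depth `ℓ` from slot `t`, outside the users of `W`, meets a slot
used by `W` or by a user explored before. -/
def Returns (ω : Config K N T) : ℕ → Fin N → Finset (Fin K) → Prop
  | 0, _, _ => False
  | ℓ + 1, t, W => ∃ x, x ∉ W ∧ t ∈ ω.1 x ∧ ∃ c ∈ ω.1 x, c ≠ t ∧
      ((∃ y ∈ W, c ∈ ω.1 y) ∨ Returns ω ℓ c (insert x W))

theorem mem_del {W : Finset (Fin K)} {ω : Config K N T} {u : Fin K} {t : Fin N} :
    t ∈ (del W ω).1 u ↔ u ∉ W ∧ t ∈ ω.1 u := by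
  unfold del
  by_cases h : u ∈ W <;> simp [h]

theorem del_del (W X : Finset (Fin K)) (ω : Config K N T) :
    del X (del W ω) = del (X ∪ W) ω := by
  refine Prod.ext (funext fun u => ?_) rfl
  by_cases h : u ∈ W <;> by_cases h' : u ∈ X <;> simp [del, h, h']

/-- Deletion only removes edges, so an exploration of the reduced frame is one of the full frame; it
avoids the deleted users because they use no slot any more. -/
theorem Returns.of_del {ω : Config K N T} {W : Finset (Fin K)} {ℓ : ℕ} {t : Fin N}
    {X : Finset (Fin K)} (h : Returns (del W ω) ℓ t X) : Returns ω ℓ t (X ∪ W) := by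
  induction ℓ generalizing t X with
  | zero => exact h
  | succ ℓ ih =>
    obtain ⟨x, hxX, htx, c, hcx, hct, hc⟩ := h
    rw [mem_del] at htx hcx
    refine ⟨x, by simp [hxX, htx.1], htx.2, c, hcx.2, hct, ?_⟩
    rcases hc with ⟨y, hy, hcy⟩ | hc
    · exact Or.inl ⟨y, by simp [hy], (mem_del.1 hcy).2⟩
    · right
      rw [← Finset.insert_union]
      exact ih hc

/-- Messages of the users of `t` do not depend on the users of `W` unless the exploration from
`t` returns. -/
theorem userUndetected_del {ω : Config K N T} {ℓ : ℕ} {t : Fin N} {W : Finset (Fin K)}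
    (h : ¬Returns ω ℓ t W) {x : Fin K} (hx : x ∉ W) (ht : t ∈ ω.1 x) :
    userUndetected ω ℓ x t ↔ userUndetected (del W ω) ℓ x t := by
  induction ℓ generalizing ω t W x with
  | zero => exact Iff.rfl
  | succ ℓ ih =>
    have key : ∀ c ∈ ω.1 x, c ≠ t → residual ω (userUndetected ω ℓ) c x =
        residual (del W ω) (userUndetected (del W ω) ℓ) c x := by
      intro c hc hct
      have h1 : ∀ y ∈ W, c ∉ ω.1 y := fun y hy hcy =>
        h ⟨x, hx, ht, c, hc, hct, Or.inl ⟨y, hy, hcy⟩⟩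
      have h2 : ¬Returns ω ℓ c (insert x W) := fun hr =>
        h ⟨x, hx, ht, c, hc, hct, Or.inr hr⟩
      -- The induction hypothesis is used twice: to delete `insert x W` from `ω`, and to delete `x`
      -- from `del W ω`. Both lead to the same frame, so the two messages agree.
      have h3 : ¬Returns (del W ω) ℓ c {x} := fun hr => h2 (by simpa using hr.of_del)
      have hdd : del {x} (del W ω) = del (insert x W) ω := by rw [del_del]; rfl
      unfold residual
      congr 2
      ext y
      simp only [mem_filter, mem_univ, true_and, mem_del]
      refine and_congr_right fun hyx => ?_
      by_cases hyW : y ∈ W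
      · simp [hyW, h1 y hyW]
      simp only [hyW, not_false_eq_true, true_and]
      refine and_congr_right fun hcy => ?_
      rw [ih h2 (by simp [hyx, hyW]) hcy, ih (ω := del W ω) h3 (by simpa using hyx)
        (mem_del.2 ⟨hyW, hcy⟩), hdd]
    constructor
    · intro hu c hc hct
      have hc' := (mem_del.1 hc).2
      rw [← key c hc' hct]
      exact hu c hc' hct
    · intro hu c hc hct
      rw [key c hc hct]
      exact hu c (mem_del.2 ⟨hx, hc⟩) hct

/-- The cavity identity at a slot: without a return, the other users of `t` send the same messages
whether `v` is present or not. The `+ 1` is the packet of `v`. -/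
theorem residual_eq_pending_del {ω : Config K N T} {ℓ : ℕ} {t : Fin N} {v : Fin K}
    (h : ¬Returns ω ℓ t {v}) :
    residual ω (userUndetected ω ℓ) t v = pending (del {v} ω) ℓ t + 1 := by
  unfold residual pending
  congr 2
  ext y
  simp only [mem_filter, mem_univ, true_and, mem_del, mem_singleton, and_assoc]
  refine and_congr_right fun hyv => and_congr_right fun hty => ?_
  exact userUndetected_del h (by simpa using hyv) hty

theorem slotUnresolved_iff_del {ω : Config K N T} {ℓ : ℕ} {t : Fin N} {v : Fin K}
    (h : ¬Returns ω ℓ t {v}) :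
    slotUnresolved ω ℓ t v ↔ t ∈ blocked (del {v} ω) (ℓ + 1) := by
  unfold slotUnresolved
  rw [residual_eq_pending_del h]
  simp [blocked, del]

/-- The user message at iteration `ℓ` reads slot messages of iteration `ℓ - 1`, whence the depth of
the exploration. At `ℓ = 0` both sides hold trivially, since every slot counts as blocked. -/
theorem userUndetected_iff_del {ω : Config K N T} {ℓ : ℕ} {s : Fin N} {v : Fin K}
    (h : ∀ t ∈ ω.1 v, t ≠ s → ¬Returns ω (ℓ - 1) t {v}) :
    userUndetected ω ℓ v s ↔ (ω.1 v).erase s ⊆ blocked (del {v} ω) ℓ := by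
  cases ℓ with
  | zero => simp [userUndetected, blocked]
  | succ ℓ =>
    constructor
    · intro hu t ht
      rw [mem_erase] at ht
      exact (slotUnresolved_iff_del (h t ht.2 ht.1)).1 (hu t ht.2 ht.1)
    · intro hu t ht hts
      exact (slotUnresolved_iff_del (h t ht hts)).2 (hu (mem_erase.2 ⟨hts, ht⟩))

/-- `residual` always counts `v`, while `pending` counts it only if it is pending. The two cases,
here and in `pending_eq_residual`, differ by one; this shift produces the step from `j + 1` to `j`
in the Poisson recursion. -/
theorem pending_eq_of_not_undetected {ω : Config K N T} {ℓ : ℕ} {t : Fin N} {v : Fin K}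
    (h : ¬(t ∈ ω.1 v ∧ userUndetected ω ℓ v t)) :
    pending ω ℓ t + 1 = residual ω (userUndetected ω ℓ) t v := by
  unfold residual pending
  congr 2
  ext y
  simp only [mem_filter, mem_univ, true_and]
  constructor
  · intro hy
    refine ⟨?_, hy⟩
    rintro rfl
    exact h hy
  · exact fun hy => hy.2

theorem pending_eq_residual {ω : Config K N T} {ℓ : ℕ} {t : Fin N} {v : Fin K}
    (h1 : t ∈ ω.1 v) (h2 : userUndetected ω ℓ v t) :
    pending ω ℓ t = residual ω (userUndetected ω ℓ) t v := by
  classical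
  unfold residual pending
  rw [← Finset.card_insert_of_notMem (a := v) (by simp)]
  congr 1
  ext y
  by_cases h : y = v
  · subst h; simp [h1, h2]
  · simp [h]

/-- Removing a user does not change the messages at a slot it does not use. -/
theorem pending_del {ω : Config K N T} {ℓ : ℕ} {t : Fin N} {v : Fin K}
    (ht : t ∉ ω.1 v) (h : ¬Returns ω ℓ t {v}) : pending ω ℓ t = pending (del {v} ω) ℓ t := by
  have := pending_eq_of_not_undetected (ℓ := ℓ) (fun h' => ht h'.1 : ¬(t ∈ ω.1 v ∧ _))
  rw [residual_eq_pending_del h] at this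
  omega

theorem mem_blocked_del {ω : Config K N T} {ℓ : ℕ} {t : Fin N} {v : Fin K}
    (ht : t ∉ ω.1 v) (h : ¬Returns ω (ℓ - 1) t {v}) :
    t ∈ blocked ω ℓ ↔ t ∈ blocked (del {v} ω) ℓ := by
  cases ℓ with
  | zero => simp [blocked]
  | succ ℓ =>
    simp only [blocked, mem_filter, mem_univ, true_and]
    rw [pending_del (ℓ := ℓ) ht h]
    rfl

end Locality

/-! ### One- and two-slot marginals of the law of a user. -/

section Weights

variable {Λ : ℝ[X]} {π : ℝ} {N : ℕ}

/-- A degree distribution: nonnegative coefficients summing to one, no degree zero. -/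
structure IsDegreeLaw (Λ : ℝ[X]) : Prop where
  nonneg : ∀ d, 0 ≤ Λ.coeff d
  zero : Λ.coeff 0 = 0
  one : Λ.eval 1 = 1

theorem IsDegreeLaw.sum_coeff (h : IsDegreeLaw Λ) {n : ℕ} (hn : Λ.natDegree ≤ n) :
    ∑ d ∈ range n, Λ.coeff (d + 1) = 1 := by
  have h1 := h.one
  rw [eval_eq_sum_range' (Nat.lt_succ_of_le hn), Finset.sum_range_succ'] at h1
  simpa [h.zero] using h1

theorem eval_derivative_eq (Λ : ℝ[X]) (z : ℝ) :
    (derivative Λ).eval z = ∑ d ∈ range Λ.natDegree, Λ.coeff (d + 1) * (d + 1) * z ^ d := by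
  by_cases h : Λ.natDegree = 0
  · rw [eq_C_of_natDegree_eq_zero h]; simp
  rw [eval_eq_sum_range' (natDegree_derivative_lt h)]
  simp [coeff_derivative]

theorem IsDegreeLaw.eval_derivative_nonneg (h : IsDegreeLaw Λ) {z : ℝ} (hz : 0 ≤ z) :
    0 ≤ (derivative Λ).eval z := by
  rw [eval_derivative_eq]
  exact Finset.sum_nonneg fun d _ => by have := h.nonneg (d + 1); positivity

/-- The weights `(d + 1) Λ_{d+1}` have total mass at most the maximal degree. All estimates on Λ' go
through this bound. -/
theorem IsDegreeLaw.sum_weighted_le (h : IsDegreeLaw Λ) {f : ℕ → ℝ} {b : ℝ}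
    (hf : ∀ d < Λ.natDegree, |f d| ≤ b) :
    |∑ d ∈ range Λ.natDegree, Λ.coeff (d + 1) * (d + 1) * f d| ≤ Λ.natDegree * b := by
  refine (Finset.abs_sum_le_sum_abs _ _).trans ?_
  calc ∑ d ∈ range Λ.natDegree, |Λ.coeff (d + 1) * (d + 1) * f d|
      ≤ ∑ d ∈ range Λ.natDegree, Λ.coeff (d + 1) * (Λ.natDegree * b) := by
        refine Finset.sum_le_sum fun d hd => ?_
        have h1 := h.nonneg (d + 1)
        have hd' := Finset.mem_range.1 hd
        have h2 : ((d : ℝ) + 1) ≤ Λ.natDegree := by exact_mod_cast hd'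
        rw [abs_mul, abs_mul, abs_of_nonneg h1, abs_of_nonneg (by positivity : (0 : ℝ) ≤ d + 1),
          mul_assoc]
        refine mul_le_mul_of_nonneg_left ?_ h1
        exact mul_le_mul h2 (hf d hd') (abs_nonneg _) (by positivity)
    _ = Λ.natDegree * b := by rw [← Finset.sum_mul, h.sum_coeff le_rfl, one_mul]

theorem abs_pow_sub_pow_le {a b : ℝ} (ha : 0 ≤ a) (ha1 : a ≤ 1) (hb : 0 ≤ b) (hb1 : b ≤ 1)
    (d : ℕ) : |a ^ d - b ^ d| ≤ d * |a - b| := by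
  induction d with
  | zero => simp
  | succ d ih =>
    have : a ^ (d + 1) - b ^ (d + 1) = a ^ d * (a - b) + (a ^ d - b ^ d) * b := by ring
    rw [this]
    refine (abs_add_le _ _).trans ?_
    rw [abs_mul, abs_mul, abs_of_nonneg hb, abs_of_nonneg (pow_nonneg ha d)]
    have h1 := pow_le_one₀ ha ha1 (n := d)
    have h2 := abs_nonneg (a - b)
    have h3 := abs_nonneg (a ^ d - b ^ d)
    push_cast
    nlinarith

theorem IsDegreeLaw.eval_derivative_lipschitz (h : IsDegreeLaw Λ) {a b : ℝ} (ha : 0 ≤ a)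
    (ha1 : a ≤ 1) (hb : 0 ≤ b) (hb1 : b ≤ 1) :
    |(derivative Λ).eval a - (derivative Λ).eval b| ≤ (Λ.natDegree : ℝ) ^ 2 * |a - b| := by
  rw [eval_derivative_eq, eval_derivative_eq, ← Finset.sum_sub_distrib]
  simp only [← mul_sub]
  refine (h.sum_weighted_le (b := Λ.natDegree * |a - b|) fun d hd => ?_).trans_eq (by ring)
  refine (abs_pow_sub_pow_le ha ha1 hb hb1 d).trans ?_
  gcongr

theorem IsDegreeLaw.eval_derivative_le (h : IsDegreeLaw Λ) {a : ℝ} (ha : 0 ≤ a)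
    (ha1 : a ≤ 1) : (derivative Λ).eval a ≤ Λ.natDegree := by
  rw [eval_derivative_eq]
  refine (le_abs_self _).trans
    ((h.sum_weighted_le (b := 1) fun d _ => ?_).trans_eq (by ring))
  rw [abs_of_nonneg (by positivity)]
  exact pow_le_one₀ ha ha1

theorem IsDegreeLaw.meanDegree_pos (h : IsDegreeLaw Λ) : 0 < meanDegree Λ := by
  have h1 : 1 ≤ meanDegree Λ := by
    unfold meanDegree
    rw [eval_derivative_eq]
    refine (h.sum_coeff le_rfl).symm.le.trans (Finset.sum_le_sum fun d _ => ?_)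
    have := h.nonneg (d + 1)
    have hd : (0 : ℝ) ≤ d := by positivity
    simp only [one_pow, mul_one]
    nlinarith
  linarith

theorem IsDegreeLaw.natDegree_pos (h : IsDegreeLaw Λ) : 1 ≤ Λ.natDegree := by
  by_contra hc
  have := h.sum_coeff (n := 0) (by omega)
  simp at this

theorem userWeight_nonneg (h : IsDegreeLaw Λ) (hπ : 0 ≤ π) (hπ1 : π ≤ 1) (A : Finset (Fin N)) :
    0 ≤ userWeight Λ π A := by
  unfold userWeight
  split_ifs
  · linarith
  · have := h.nonneg A.card
    positivity

theorem userWeight_isUserLaw (h : IsDegreeLaw Λ) (hπ : 0 ≤ π) (hπ1 : π ≤ 1)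
    (hN : Λ.natDegree ≤ N) : IsUserLaw Λ.natDegree (userWeight (N := N) Λ π) where
  nonneg := userWeight_nonneg h hπ hπ1
  sum_one := by
    have h1 : ∀ A : Finset (Fin N), userWeight Λ π A =
        (fun d : ℕ => if d = 0 then 1 - π else π * (Λ.coeff d / (N.choose d : ℝ))) A.card := by
      intro A
      simp [userWeight]
    rw [Finset.sum_congr rfl fun A _ => h1 A, ← Finset.powerset_univ,
      Finset.sum_powerset_apply_card (fun d : ℕ => if d = 0 then 1 - π else
        π * (Λ.coeff d / (N.choose d : ℝ))), Finset.sum_range_succ']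
    simp only [Finset.card_univ, Fintype.card_fin, nsmul_eq_mul]
    -- The number of sets of each size cancels the uniform weight; `natDegree ≤ N` ensures that no
    -- degree of positive weight is lost.
    have h2 : ∑ d ∈ range N, ((N.choose (d + 1) : ℕ) : ℝ) *
        (if d + 1 = 0 then 1 - π else π * (Λ.coeff (d + 1) / (N.choose (d + 1) : ℝ))) =
        ∑ d ∈ range N, π * Λ.coeff (d + 1) := by
      refine Finset.sum_congr rfl fun d hd => ?_
      have : (0 : ℝ) < (N.choose (d + 1) : ℕ) := by
        exact_mod_cast Nat.choose_pos (Finset.mem_range.1 hd)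
      simp
      field_simp
    rw [h2, ← Finset.mul_sum, h.sum_coeff hN]
    simp
  card_le A hA := by
    by_contra hc
    push Not at hc
    apply hA
    have : A ≠ ∅ := by rintro rfl; simp at hc
    simp [userWeight, this, coeff_eq_zero_of_natDegree_lt hc]

/-- Probability that a user transmits in slot `s` and all its other slots belong to `X`. -/
noncomputable def touchWeight (Λ : ℝ[X]) (π : ℝ) (s : Fin N) (X : Finset (Fin N)) : ℝ :=
  ∑ A, userWeight Λ π A * (ind (s ∈ A) * ind (A.erase s ⊆ X))

/-- The sets that count are `insert s B` with `B ⊆ X.erase s`, and their weight depends on `B` only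
through its size. -/
theorem touchWeight_eq (s : Fin N) (X : Finset (Fin N)) :
    touchWeight Λ π s X = ∑ d ∈ range Λ.natDegree,
      π * (Λ.coeff (d + 1) / (N.choose (d + 1) : ℝ)) * ((X.erase s).card.choose d : ℝ) := by
  have h1 : touchWeight Λ π s X =
      ∑ B ∈ (X.erase s).powerset, (fun d : ℕ => π * (Λ.coeff (d + 1) / (N.choose (d + 1) : ℝ)))
        B.card := by
    unfold touchWeight
    symm
    rw [← Finset.sum_subset (s₁ := (X.erase s).powerset.image (insert s)) (Finset.subset_univ _)]
    · rw [Finset.sum_image]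
      · refine Finset.sum_congr rfl fun B hB => ?_
        have hB' := Finset.mem_powerset.1 hB
        have hs : s ∉ B := fun h => by simpa using hB' h
        rw [ind_of (by simp), ind_of (by
          rw [Finset.erase_insert hs]; exact hB'.trans (Finset.erase_subset _ _))]
        simp [userWeight, Finset.card_insert_of_notMem hs]
      · intro B hB B' hB' hBB
        have hs : s ∉ B := fun h => by simpa using Finset.mem_powerset.1 hB h
        have hs' : s ∉ B' := fun h => by simpa using Finset.mem_powerset.1 hB' h
        rw [← Finset.erase_insert hs, hBB, Finset.erase_insert hs']
    · intro A _ hA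
      by_cases hs : s ∈ A
      · rw [ind_of_not (p := A.erase s ⊆ X)]
        · simp
        · intro hX
          apply hA
          refine Finset.mem_image.2 ⟨A.erase s, ?_, Finset.insert_erase hs⟩
          rw [Finset.mem_powerset]
          exact Finset.erase_subset_erase s hX |>.trans' (by simp)
      · rw [ind_of_not hs]; simp
  rw [h1, Finset.sum_powerset_apply_card
    (fun d : ℕ => π * (Λ.coeff (d + 1) / (N.choose (d + 1) : ℝ)))]
  simp only [nsmul_eq_mul]
  set m := (X.erase s).card
  -- Both sums are extended to a common range; the extra terms vanish through the binomial on one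
  -- side and the coefficient on the other.
  rw [Finset.sum_subset (Finset.range_mono (le_max_left (m + 1) Λ.natDegree)),
    Finset.sum_subset (Finset.range_mono (le_max_right (m + 1) Λ.natDegree))
      (f := fun d => π * (Λ.coeff (d + 1) / (N.choose (d + 1) : ℝ)) * (m.choose d : ℝ))]
  · exact Finset.sum_congr rfl fun d _ => by ring
  · intro d _ hd
    rw [coeff_eq_zero_of_natDegree_lt (by simp at hd; omega)]
    simp
  · intro d _ hd
    rw [Nat.choose_eq_zero_of_lt (by simp at hd; omega)]
    simp

/-- Sampling without replacement is close to sampling with replacement. The ratio is a product of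
factors `(m - i)/(N - 1 - i)`, each within `2D/N` of `x/N`, and the errors add up because all
factors lie in [0, 1]. Here `x` is the size of a set and `m` its size once the slot `s` is removed.
-/
theorem abs_choose_ratio_sub_pow_le {D x m : ℕ} (hN : 2 * D ≤ N) (hmx : m ≤ x) (hxm : x ≤ m + 1)
    (hm : m ≤ N - 1) (hxN : x ≤ N) {d : ℕ} (hd : d < D) :
    |(m.choose d : ℝ) / ((N - 1).choose d : ℝ) - ((x : ℝ) / N) ^ d| ≤ 2 * D * d / N := by
  have hN0 : (0 : ℝ) < N := by exact_mod_cast (by omega : 0 < N)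
  have hz0 : (0 : ℝ) ≤ (x : ℝ) / N := by positivity
  have hz1 : (x : ℝ) / N ≤ 1 := by rw [div_le_one hN0]; exact_mod_cast hxN
  induction d with
  | zero => simp
  | succ d ih =>
    have ih := ih (by omega)
    obtain ⟨M, rfl⟩ : ∃ M, N = M + 1 := ⟨N - 1, by omega⟩
    simp only [Nat.add_sub_cancel] at *
    have hMd : (0 : ℝ) < ((M - d : ℕ) : ℝ) := by exact_mod_cast (by omega : 0 < M - d)
    have hc : (0 : ℝ) < (M.choose d : ℝ) := by exact_mod_cast Nat.choose_pos (by omega)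
    have hc1 : (0 : ℝ) < (M.choose (d + 1) : ℝ) := by exact_mod_cast Nat.choose_pos (by omega)
    have e1 : (m.choose (d + 1) : ℝ) * (d + 1) = m.choose d * ((m - d : ℕ) : ℝ) := by
      exact_mod_cast Nat.choose_succ_right_eq m d
    have e2 : (M.choose (d + 1) : ℝ) * (d + 1) = M.choose d * ((M - d : ℕ) : ℝ) := by
      exact_mod_cast Nat.choose_succ_right_eq M d
    set r := ((m - d : ℕ) : ℝ) / ((M - d : ℕ) : ℝ) with hr
    have hratio : (m.choose (d + 1) : ℝ) / (M.choose (d + 1) : ℝ) =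
        (m.choose d : ℝ) / (M.choose d : ℝ) * r := by
      rw [hr, div_mul_div_comm, ← e1, ← e2]
      field_simp
    have hr0 : 0 ≤ r := by positivity
    have hr1 : r ≤ 1 := by
      rw [hr, div_le_one hMd]; exact_mod_cast (by omega : m - d ≤ M - d)
    have hrz : |r - (x : ℝ) / ((M + 1 : ℕ) : ℝ)| ≤ 2 * D / ((M + 1 : ℕ) : ℝ) := by
      have hxm' : (x : ℝ) ≤ m + 1 := by exact_mod_cast hxm
      have hmx' : (m : ℝ) ≤ x := by exact_mod_cast hmx
      have hd' : (d : ℝ) + 2 ≤ D := by exact_mod_cast (by omega : d + 2 ≤ D)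
      have hND' : 2 * (D : ℝ) ≤ ((M + 1 : ℕ) : ℝ) := by exact_mod_cast hN
      have hxN' : (x : ℝ) ≤ ((M + 1 : ℕ) : ℝ) := by exact_mod_cast hxN
      -- If `d > m`, truncated subtraction makes the factor `r` zero, and then `x ≤ m + 1 ≤ d`, so
      -- `x/N` is itself small.
      by_cases hmd : d ≤ m
      · have hcast : ((M - d : ℕ) : ℝ) = ((M + 1 : ℕ) : ℝ) - 1 - d := by
          rw [Nat.cast_sub (by omega)]; push_cast; ring
        rw [hcast] at hMd
        rw [hr, hcast, Nat.cast_sub hmd, div_sub_div _ _ hMd.ne' hN0.ne', abs_div,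
          abs_of_pos (mul_pos hMd hN0), div_le_div_iff₀ (mul_pos hMd hN0) hN0]
        set n : ℝ := ((M + 1 : ℕ) : ℝ)
        have hd0 : (0 : ℝ) ≤ d := by positivity
        have hx0 : (0 : ℝ) ≤ x := by positivity
        have hab : |((m : ℝ) - d) * n - (n - 1 - d) * x| ≤ n * (d + 1) := by
          rw [abs_le]
          constructor <;> nlinarith
        have : n * (d + 1) * n ≤ 2 * D * ((n - 1 - d) * n) := by
          have h5 : n * (d + 1) ≤ 2 * D * (n - 1 - d) := by nlinarith
          nlinarith
        nlinarith
      · have : m - d = 0 := by omega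
        rw [hr, this]
        simp only [Nat.cast_zero, zero_div, zero_sub, abs_neg, abs_of_nonneg hz0]
        have : (x : ℝ) ≤ d := by exact_mod_cast (by omega : x ≤ d)
        gcongr
        linarith
    have hzd : |((x : ℝ) / ((M + 1 : ℕ) : ℝ)) ^ d| ≤ 1 := by
      rw [abs_of_nonneg (by positivity)]
      exact pow_le_one₀ hz0 hz1
    rw [hratio]
    set ρ := (m.choose d : ℝ) / (M.choose d : ℝ)
    set z := (x : ℝ) / ((M + 1 : ℕ) : ℝ)
    have : ρ * r - z ^ (d + 1) = (ρ - z ^ d) * r + z ^ d * (r - z) := by ring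
    rw [this]
    refine (abs_add_le _ _).trans ?_
    rw [abs_mul, abs_mul, abs_of_nonneg hr0]
    have h1 : |ρ - z ^ d| * r ≤ |ρ - z ^ d| := mul_le_of_le_one_right (abs_nonneg _) hr1
    have h2 : |z ^ d| * |r - z| ≤ |r - z| := mul_le_of_le_one_left (abs_nonneg _) hzd
    have h3 : 2 * (D : ℝ) * ((d + 1 : ℕ) : ℝ) / ((M + 1 : ℕ) : ℝ) =
      2 * D * d / ((M + 1 : ℕ) : ℝ) + 2 * D / ((M + 1 : ℕ) : ℝ) := by push_cast; ring
    rw [h3]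
    linarith

/-- The identity `N / C(N, d+1) = (d+1) / C(N-1, d)` turns the degree weights into the coefficients
of Λ', and the remaining ratio of binomials is close to a power of `|X|/N`. This is how Λ' enters
the recursion. -/
theorem touchWeight_approx (h : IsDegreeLaw Λ) (hπ : 0 ≤ π) (hπ1 : π ≤ 1)
    (hN : 2 * Λ.natDegree ≤ N) (s : Fin N) (X : Finset (Fin N)) :
    |N * touchWeight Λ π s X - π * (derivative Λ).eval ((X.card : ℝ) / N)| ≤
      2 * (Λ.natDegree : ℝ) ^ 3 / N := by
  have hN0 : (0 : ℝ) < N := by exact_mod_cast (Nat.lt_of_le_of_lt (Nat.zero_le _) s.isLt)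
  rw [touchWeight_eq, eval_derivative_eq, Finset.mul_sum, Finset.mul_sum, ← Finset.sum_sub_distrib]
  set m := (X.erase s).card with hm
  have hm1 : m ≤ N - 1 := by
    have := Finset.card_le_card (Finset.erase_subset_erase s (Finset.subset_univ X))
    simpa using this
  have hmx : m ≤ X.card := Finset.card_le_card (Finset.erase_subset _ _)
  have hxm : X.card ≤ m + 1 := by
    have := Finset.pred_card_le_card_erase (s := X) (a := s)
    omega
  have hxN : X.card ≤ N := by simpa using Finset.card_le_univ X
  have key : ∀ d ∈ range Λ.natDegree,
      N * (π * (Λ.coeff (d + 1) / (N.choose (d + 1) : ℝ)) * (m.choose d : ℝ)) -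
        π * (Λ.coeff (d + 1) * (d + 1) * ((X.card : ℝ) / N) ^ d) =
      Λ.coeff (d + 1) * (d + 1) *
        (π * ((m.choose d : ℝ) / ((N - 1).choose d : ℝ) - ((X.card : ℝ) / N) ^ d)) := by
    intro d hd
    have hd' := Finset.mem_range.1 hd
    have hc : (0 : ℝ) < ((N - 1).choose d : ℝ) := by exact_mod_cast Nat.choose_pos (by omega)
    have hc1 : (0 : ℝ) < (N.choose (d + 1) : ℝ) := by exact_mod_cast Nat.choose_pos (by omega)
    have e : (N : ℝ) * ((N - 1).choose d : ℝ) = (N.choose (d + 1) : ℝ) * (d + 1) := by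
      have := Nat.add_one_mul_choose_eq (N - 1) d
      rw [Nat.sub_add_cancel (by omega)] at this
      exact_mod_cast this
    have e' : (N : ℝ) / (N.choose (d + 1) : ℝ) = (d + 1) / ((N - 1).choose d : ℝ) := by
      rw [div_eq_div_iff hc1.ne' hc.ne', e]; ring
    have : N * (π * (Λ.coeff (d + 1) / (N.choose (d + 1) : ℝ)) * (m.choose d : ℝ)) =
      π * Λ.coeff (d + 1) * m.choose d * ((N : ℝ) / (N.choose (d + 1) : ℝ)) := by ring
    rw [this, e']
    ring
  rw [Finset.sum_congr rfl key]
  refine (h.sum_weighted_le (b := 2 * (Λ.natDegree : ℝ) ^ 2 / N) fun d hd => ?_).trans_eq (by ring)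
  rw [abs_mul, abs_of_nonneg hπ]
  refine (mul_le_of_le_one_left (abs_nonneg _) hπ1).trans ?_
  refine (abs_choose_ratio_sub_pow_le hN hmx hxm hm1 hxN hd).trans ?_
  have : (d : ℝ) ≤ Λ.natDegree := by exact_mod_cast hd.le
  rw [pow_two, ← mul_assoc]
  gcongr

theorem touchWeight_univ (hN : Λ.natDegree ≤ N) (s : Fin N) :
    touchWeight Λ π s univ = π * meanDegree Λ / N := by
  have hN0 : (0 : ℝ) < N := by exact_mod_cast (Nat.lt_of_le_of_lt (Nat.zero_le _) s.isLt)
  rw [touchWeight_eq, meanDegree, eval_derivative_eq, Finset.mul_sum, Finset.sum_div]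
  refine Finset.sum_congr rfl fun d hd => ?_
  have hd' := Finset.mem_range.1 hd
  have hm : ((univ : Finset (Fin N)).erase s).card = N - 1 := by simp
  have hc1 : (0 : ℝ) < (N.choose (d + 1) : ℝ) := by exact_mod_cast Nat.choose_pos (by omega)
  have e : (N : ℝ) * ((N - 1).choose d : ℝ) = (N.choose (d + 1) : ℝ) * (d + 1) := by
    have := Nat.add_one_mul_choose_eq (N - 1) d
    rw [Nat.sub_add_cancel (by omega)] at this
    exact_mod_cast this
  rw [hm]
  field_simp
  linear_combination π * Λ.coeff (d + 1) * e

theorem sum_userWeight_mem (s : Fin N) :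
    ∑ A, userWeight Λ π A * ind (s ∈ A) = touchWeight Λ π s univ := by
  unfold touchWeight
  refine Finset.sum_congr rfl fun A _ => ?_
  rw [ind_of (Finset.subset_univ (A.erase s)), mul_one]

/-- Bounds for the one- and two-slot marginals of the law of a user. -/
structure IsSparse (C : ℝ) (μ : Finset (Fin N) → ℝ) : Prop where
  mem_le : ∀ t, ∑ A, μ A * ind (t ∈ A) ≤ C / N
  pair_le : ∀ t c, c ≠ t → ∑ A, μ A * (ind (t ∈ A) * ind (c ∈ A)) ≤ C / (N : ℝ) ^ 2

/-- The pair probability is a difference of two values of `touchWeight`, with all slots allowed and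
with `c` forbidden. The constant is 5 = 2 + 2 + 1: two errors of `touchWeight_approx`, and one for
the variation of Λ' between 1 and 1 - 1/N. -/
theorem userWeight_isSparse (h : IsDegreeLaw Λ) (hπ : 0 ≤ π) (hπ1 : π ≤ 1)
    (hN : 2 * Λ.natDegree ≤ N) :
    IsSparse (5 * (Λ.natDegree : ℝ) ^ 3) (userWeight (N := N) Λ π) := by
  have hD : (1 : ℝ) ≤ Λ.natDegree := by exact_mod_cast h.natDegree_pos
  constructor
  · intro t
    rw [sum_userWeight_mem, touchWeight_univ (by omega)]
    refine div_le_div_of_nonneg_right ?_ (by positivity)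
    have h1 : meanDegree Λ ≤ Λ.natDegree := h.eval_derivative_le zero_le_one le_rfl
    have h2 := h.meanDegree_pos
    calc π * meanDegree Λ ≤ 1 * Λ.natDegree := by gcongr
      _ ≤ 5 * (Λ.natDegree : ℝ) ^ 3 := by nlinarith [pow_le_pow_right₀ hD (show 1 ≤ 3 by norm_num)]
  · intro t c hct
    have hN0 : (0 : ℝ) < N := by exact_mod_cast (Nat.lt_of_le_of_lt (Nat.zero_le _) t.isLt)
    have e : ∑ A : Finset (Fin N), userWeight Λ π A * (ind (t ∈ A) * ind (c ∈ A)) =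
        touchWeight Λ π t univ - touchWeight Λ π t (univ.erase c) := by
      unfold touchWeight
      rw [← Finset.sum_sub_distrib]
      refine Finset.sum_congr rfl fun A _ => ?_
      have : ind (A.erase t ⊆ univ.erase c) = 1 - ind (c ∈ A) := by
        by_cases hc : c ∈ A
        · rw [ind_of hc, ind_of_not]
          · ring
          · intro hs
            simpa using hs (Finset.mem_erase.2 ⟨hct, hc⟩)
        · rw [ind_of_not hc, ind_of]
          · ring
          · intro a ha
            refine Finset.mem_erase.2 ⟨?_, Finset.mem_univ _⟩
            rintro rfl
            exact hc (Finset.mem_of_mem_erase ha)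
      rw [this, ind_of (Finset.subset_univ (A.erase t))]
      ring
    rw [e]
    have a1 := touchWeight_approx h hπ hπ1 hN t univ
    have a2 := touchWeight_approx h hπ hπ1 hN t (univ.erase c)
    have hx : (((univ : Finset (Fin N)).card : ℝ) / N) = 1 := by simp [hN0.ne']
    have hN1 : 1 ≤ N := by exact_mod_cast hN0
    have hy : ((((univ : Finset (Fin N)).erase c).card : ℝ) / N) = 1 - 1 / N := by
      rw [Finset.card_erase_of_mem (Finset.mem_univ c), Finset.card_univ, Fintype.card_fin,
        Nat.cast_sub hN1]
      field_simp
      simp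
    rw [hx] at a1
    rw [hy] at a2
    have hN1' : (1 : ℝ) ≤ N := by exact_mod_cast hN1
    have hi : 1 / (N : ℝ) ≤ 1 := by rw [div_le_one hN0]; exact hN1'
    have a3 := h.eval_derivative_lipschitz (a := 1) (b := 1 - 1 / N) zero_le_one le_rfl
      (by linarith) (by have : (0 : ℝ) ≤ 1 / N := by positivity
                        linarith)
    rw [sub_sub_cancel, abs_of_nonneg (by positivity : (0 : ℝ) ≤ 1 / N)] at a3
    set e1 := (derivative Λ).eval (1 : ℝ)
    set e2 := (derivative Λ).eval (1 - 1 / (N : ℝ))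
    have a4 : |π * (e1 - e2)| ≤ (Λ.natDegree : ℝ) ^ 2 * (1 / N) := by
      rw [abs_mul, abs_of_nonneg hπ]
      exact (mul_le_of_le_one_left (abs_nonneg _) hπ1).trans a3
    have a5 : (Λ.natDegree : ℝ) ^ 2 * (1 / N) ≤ (Λ.natDegree : ℝ) ^ 3 / N := by
      rw [mul_one_div]
      exact div_le_div_of_nonneg_right (pow_le_pow_right₀ hD (by norm_num)) hN0.le
    have key : N * (touchWeight Λ π t univ - touchWeight Λ π t (univ.erase c)) ≤
        5 * (Λ.natDegree : ℝ) ^ 3 / N := by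
      have b1 := (abs_le.1 a1).2
      have b2 := (abs_le.1 a2).1
      have b4 := (abs_le.1 a4).2
      have : 5 * (Λ.natDegree : ℝ) ^ 3 / N = 2 * (Λ.natDegree : ℝ) ^ 3 / N +
        2 * (Λ.natDegree : ℝ) ^ 3 / N + (Λ.natDegree : ℝ) ^ 3 / N := by ring
      linarith
    rw [pow_two, ← div_div, le_div_iff₀ hN0]
    linarith

end Weights

/-! ### First-moment bound on returning explorations. -/

section Returns

variable {K N T : ℕ} {PE : ℕ → ℝ} {w : Fin K → Finset (Fin N) → ℝ} {D : ℕ}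

theorem sum_ind_mem (A : Finset (Fin N)) : ∑ c, ind (c ∈ A) = (A.card : ℝ) := by
  have h : ∀ c, ind (c ∈ A) = if c ∈ A then 1 else 0 := fun c => by
    by_cases hc : c ∈ A <;> simp [ind, hc]
  simp [h]

theorem IsUserLaw.sum_mem_le {ν : Finset (Fin N) → ℝ} (hν : IsUserLaw D ν) :
    ∑ c, ∑ A, ν A * ind (c ∈ A) ≤ (D : ℝ) := by
  rw [Finset.sum_comm]
  simp only [← Finset.mul_sum, sum_ind_mem]
  calc ∑ A, ν A * (A.card : ℝ) ≤ ∑ A, ν A * (D : ℝ) := by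
        refine Finset.sum_le_sum fun A _ => ?_
        by_cases hA : ν A = 0
        · simp [hA]
        · have := hν.nonneg A
          have := hν.card_le A hA
          gcongr
    _ = D := by rw [← Finset.sum_mul, hν.sum_one, one_mul]

/-- `N` times this bounds the probability that the exploration of depth `ℓ` returns to a set of
`r` users. -/
def returnBound (C M : ℝ) (D : ℕ) : ℕ → ℕ → ℝ
  | 0, _ => 0
  | ℓ + 1, r => M * (C * (D * r + D * returnBound C M D ℓ (r + 1)))

theorem returnBound_nonneg {C M : ℝ} (hC : 0 ≤ C) (hM : 0 ≤ M) (D ℓ r : ℕ) :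
    0 ≤ returnBound C M D ℓ r := by
  induction ℓ generalizing r with
  | zero => exact le_rfl
  | succ ℓ ih =>
    have := ih (r + 1)
    unfold returnBound
    positivity

/-- Union bound over the first user `x`, its exit slot `c`, and the way in which the exploration
closes. -/
theorem ind_returns_succ_le (ω : Config K N T) (ℓ : ℕ) (t : Fin N) (W : Finset (Fin K)) :
    ind (Returns ω (ℓ + 1) t W) ≤ ∑ x ∈ univ \ W, ∑ c ∈ univ.erase t,
      ind (t ∈ ω.1 x) * ind (c ∈ ω.1 x) *
        (∑ y ∈ W, ind (c ∈ ω.1 y) + ind (Returns ω ℓ c (insert x W))) := by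
  have hnn : ∀ x c, 0 ≤ ind (t ∈ ω.1 x) * ind (c ∈ ω.1 x) *
        (∑ y ∈ W, ind (c ∈ ω.1 y) + ind (Returns ω ℓ c (insert x W))) := fun x c =>
    mul_nonneg (mul_nonneg (ind_nonneg _) (ind_nonneg _))
      (add_nonneg (Finset.sum_nonneg fun _ _ => ind_nonneg _) (ind_nonneg _))
  by_cases h : Returns ω (ℓ + 1) t W
  · rw [ind_of h]
    obtain ⟨x, hx, htx, c, hcx, hct, hc⟩ := h
    refine le_trans ?_ (Finset.single_le_sum (fun x _ => Finset.sum_nonneg fun c _ => hnn x c)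
      (a := x) (by simp [hx]))
    refine le_trans ?_ (Finset.single_le_sum (fun c _ => hnn x c) (a := c) (by simp [hct]))
    rw [ind_of htx, ind_of hcx, one_mul, one_mul]
    rcases hc with ⟨y, hy, hcy⟩ | hc
    · have := Finset.single_le_sum (s := W) (f := fun y => ind (c ∈ ω.1 y))
        (fun _ _ => ind_nonneg _) hy
      simp only [ind_of hcy] at this
      linarith [ind_nonneg (Returns ω ℓ c (insert x W))]
    · rw [ind_of hc]
      linarith [Finset.sum_nonneg (s := W) (f := fun y => ind (c ∈ ω.1 y))
        (fun _ _ => ind_nonneg _)]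
  · rw [ind_of_not h]
    exact Finset.sum_nonneg fun x _ => Finset.sum_nonneg fun c _ => hnn x c

/-- Each first user `x` contributes O(1/N²): either it joins `t` to a slot of `W`, at cost C/N² per
slot, or it uses `t`, at cost C/N, and one of its at most `D` slots returns later, at cost O(1/N).
There are at most `M N` choices of `x`. The users of `W` keep arbitrary laws, so that after
conditioning on the slots of `x` the induction hypothesis applies with `x` added to `W`. -/
theorem Ex_returns_le {C M : ℝ} (hM : 0 ≤ M) (hC : 0 ≤ C) (hs : IsSlotLaw T PE)
    {μ : Finset (Fin N) → ℝ} (hμ : IsSparse C μ) (hK : (K : ℝ) ≤ M * N) (ℓ : ℕ) (t : Fin N)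
    (W : Finset (Fin K)) (hw : ∀ u, IsUserLaw D (w u)) (hwμ : ∀ u ∉ W, w u = μ) :
    Ex PE w (fun ω : Config K N T => ind (Returns ω ℓ t W)) ≤
      returnBound C M D ℓ W.card / N := by
  have hN0 : (0 : ℝ) < N := by exact_mod_cast (Nat.lt_of_le_of_lt (Nat.zero_le _) t.isLt)
  induction ℓ generalizing t W w with
  | zero =>
    have : (fun ω : Config K N T => ind (Returns ω 0 t W)) = fun _ => 0 :=
      funext fun ω => ind_of_not fun h => h
    rw [this, Ex_const hw hs]
    simp [returnBound]
  | succ ℓ ih =>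
    set R := returnBound C M D ℓ (W.card + 1) with hR
    have hR0 : 0 ≤ R := returnBound_nonneg hC hM _ _ _
    have step : ∀ x ∈ univ \ W, Ex PE w (fun ω : Config K N T => ∑ c ∈ univ.erase t,
        ind (t ∈ ω.1 x) * ind (c ∈ ω.1 x) *
        (∑ y ∈ W, ind (c ∈ ω.1 y) + ind (Returns ω ℓ c (insert x W)))) ≤
        C / (N : ℝ) ^ 2 * (D * W.card + D * R) := by
      intro x hx
      have hxW : x ∉ W := by simpa using hx
      have hμlaw : IsUserLaw D μ := hwμ x hxW ▸ hw x
      set ρ : Fin K → Fin N → ℝ := fun y c => ∑ B, w y B * ind (c ∈ B) with hρ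
      have hρ0 : ∀ y c, 0 ≤ ρ y c := fun y c =>
        Finset.sum_nonneg fun B _ => mul_nonneg ((hw y).nonneg _) (ind_nonneg _)
      have hcondA : ∀ A, μ A ≠ 0 → Ex PE (Function.update w x (dirac A))
          (fun ω : Config K N T => ∑ c ∈ univ.erase t, ind (t ∈ ω.1 x) * ind (c ∈ ω.1 x) *
            (∑ y ∈ W, ind (c ∈ ω.1 y) + ind (Returns ω ℓ c (insert x W)))) ≤
          ∑ c ∈ univ.erase t, ind (t ∈ A) * ind (c ∈ A) * (∑ y ∈ W, ρ y c + R / N) := by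
        intro A hA
        have hwA := update_isUserLaw hw x (dirac_isUserLaw (hμlaw.card_le A hA))
        rw [Ex_dirac_congr x A (g := fun ω => ∑ c ∈ univ.erase t, ind (t ∈ A) * ind (c ∈ A) *
            (∑ y ∈ W, ind (c ∈ ω.1 y) + ind (Returns ω ℓ c (insert x W))))
            fun ω h => by rw [h], Ex_sum]
        refine Finset.sum_le_sum fun c _ => ?_
        rw [Ex_const_mul, Ex_add (fun ω => ∑ y ∈ W, ind (c ∈ ω.1 y)), Ex_sum]
        refine mul_le_mul_of_nonneg_left (add_le_add (Finset.sum_le_sum fun y hy => le_of_eq ?_) ?_)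
          (mul_nonneg (ind_nonneg _) (ind_nonneg _))
        · rw [Ex_user hwA hs y (fun B => ind (c ∈ B))]
          have : y ≠ x := fun h => hxW (h ▸ hy)
          rw [Function.update_of_ne this]
        · have := ih c (insert x W) hwA fun u hu => by
            rw [Finset.mem_insert, not_or] at hu
            rw [Function.update_of_ne hu.1]
            exact hwμ u hu.2
          rwa [Finset.card_insert_of_notMem hxW] at this
      rw [Ex_cond x, hwμ x hxW]
      have h1 : ∑ A, μ A * Ex PE (Function.update w x (dirac A))
          (fun ω : Config K N T => ∑ c ∈ univ.erase t, ind (t ∈ ω.1 x) * ind (c ∈ ω.1 x) *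
            (∑ y ∈ W, ind (c ∈ ω.1 y) + ind (Returns ω ℓ c (insert x W)))) ≤
          ∑ A, μ A * ∑ c ∈ univ.erase t, ind (t ∈ A) * ind (c ∈ A) * (∑ y ∈ W, ρ y c + R / N) := by
        refine Finset.sum_le_sum fun A _ => ?_
        by_cases hA : μ A = 0
        · simp [hA]
        · exact mul_le_mul_of_nonneg_left (hcondA A hA) (hμlaw.nonneg A)
      refine h1.trans ?_
      -- The two ways of closing are separated: the first uses the pair marginals, the second the
      -- single-slot marginal and the bound `D` on the degree.
      have h2 : ∑ A, μ A * ∑ c ∈ univ.erase t, ind (t ∈ A) * ind (c ∈ A) *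
            (∑ y ∈ W, ρ y c + R / N) =
          ∑ c ∈ univ.erase t, (∑ A, μ A * (ind (t ∈ A) * ind (c ∈ A))) * ∑ y ∈ W, ρ y c +
          (∑ A, μ A * ind (t ∈ A) * ∑ c ∈ univ.erase t, ind (c ∈ A)) * (R / N) := by
        simp only [Finset.mul_sum, Finset.sum_mul, mul_add, Finset.sum_add_distrib]
        congr 1
        · rw [Finset.sum_comm]
          refine Finset.sum_congr rfl fun c _ => ?_
          rw [Finset.sum_comm]
          refine Finset.sum_congr rfl fun y _ => Finset.sum_congr rfl fun A _ => ?_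
          ring
        · refine Finset.sum_congr rfl fun A _ => Finset.sum_congr rfl fun c _ => ?_
          ring
      rw [h2]
      have h3 : ∑ c ∈ univ.erase t, (∑ A, μ A * (ind (t ∈ A) * ind (c ∈ A))) * ∑ y ∈ W, ρ y c ≤
          C / (N : ℝ) ^ 2 * (D * W.card) := by
        calc _ ≤ ∑ c ∈ univ.erase t, C / (N : ℝ) ^ 2 * ∑ y ∈ W, ρ y c := by
              refine Finset.sum_le_sum fun c hc => mul_le_mul_of_nonneg_right
                (hμ.pair_le t c (Finset.ne_of_mem_erase hc)) (Finset.sum_nonneg fun y _ => hρ0 y c)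
          _ ≤ C / (N : ℝ) ^ 2 * (D * W.card) := by
              rw [← Finset.mul_sum]
              refine mul_le_mul_of_nonneg_left ?_ (by positivity)
              calc ∑ c ∈ univ.erase t, ∑ y ∈ W, ρ y c ≤ ∑ c, ∑ y ∈ W, ρ y c :=
                    Finset.sum_le_sum_of_subset_of_nonneg (Finset.subset_univ _)
                      fun c _ _ => Finset.sum_nonneg fun y _ => hρ0 y c
                _ = ∑ y ∈ W, ∑ c, ρ y c := Finset.sum_comm
                _ ≤ ∑ y ∈ W, (D : ℝ) := Finset.sum_le_sum fun y _ => (hw y).sum_mem_le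
                _ = D * W.card := by rw [Finset.sum_const, nsmul_eq_mul]; ring
      have h4 : ∑ A, μ A * ind (t ∈ A) * ∑ c ∈ univ.erase t, ind (c ∈ A) ≤ C / N * D := by
        calc _ ≤ ∑ A, μ A * ind (t ∈ A) * D := by
              refine Finset.sum_le_sum fun A _ => ?_
              by_cases hA : μ A = 0
              · simp [hA]
              · refine mul_le_mul_of_nonneg_left ?_ (mul_nonneg (hμlaw.nonneg A) (ind_nonneg _))
                calc ∑ c ∈ univ.erase t, ind (c ∈ A) ≤ ∑ c, ind (c ∈ A) :=
                      Finset.sum_le_sum_of_subset_of_nonneg (Finset.subset_univ _)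
                        fun c _ _ => ind_nonneg _
                  _ ≤ D := by
                      rw [sum_ind_mem]
                      exact_mod_cast hμlaw.card_le A hA
          _ ≤ C / N * D := by
              rw [← Finset.sum_mul]
              exact mul_le_mul_of_nonneg_right (hμ.mem_le t) (by positivity)
      have h5 := mul_le_mul_of_nonneg_right h4 (by positivity : 0 ≤ R / N)
      have h6 : C / N * D * (R / N) = C / (N : ℝ) ^ 2 * (D * R) := by field_simp
      rw [h6] at h5
      rw [mul_add]
      exact add_le_add h3 h5
    calc Ex PE w (fun ω : Config K N T => ind (Returns ω (ℓ + 1) t W))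
        ≤ ∑ x ∈ univ \ W, C / (N : ℝ) ^ 2 * (D * W.card + D * R) := by
          refine (Ex_mono hw hs fun ω => ind_returns_succ_le ω ℓ t W).trans ?_
          rw [Ex_sum]
          exact Finset.sum_le_sum step
      _ ≤ K * (C / (N : ℝ) ^ 2 * (D * W.card + D * R)) := by
          rw [Finset.sum_const, nsmul_eq_mul]
          have : (univ \ W).card ≤ K := by simpa using Finset.card_le_univ (univ \ W)
          have : ((univ \ W).card : ℝ) ≤ K := by exact_mod_cast this
          gcongr
      _ ≤ M * N * (C / (N : ℝ) ^ 2 * (D * W.card + D * R)) := by gcongr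
      _ = returnBound C M D (ℓ + 1) W.card / N := by
          rw [returnBound]
          field_simp
          rw [hR]

end Returns

/-! ### Cavity and mean-field estimates for a single edge. -/

section Cavity

variable {Λ : ℝ[X]} {π : ℝ} {T : ℕ} {PE : ℕ → ℝ}

/-- Standing assumptions on the degree distribution, the activity and the slot decoder. -/
structure Setting (Λ : ℝ[X]) (π : ℝ) (T : ℕ) (PE : ℕ → ℝ) : Prop where
  degree : IsDegreeLaw Λ
  active_pos : 0 < π
  active_le : π ≤ 1
  slot : IsSlotLaw T PE

/-- Expectation in the model: all users have the law `userWeight`. -/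
noncomputable def mean (Λ : ℝ[X]) (π : ℝ) (PE : ℕ → ℝ) {K N T : ℕ} (f : Config K N T → ℝ) : ℝ :=
  Ex PE (fun _ => userWeight Λ π) f

/-- Expectation in the model when user `v` has the law `ν`. -/
noncomputable def meanWith (Λ : ℝ[X]) (π : ℝ) (PE : ℕ → ℝ) {K N T : ℕ} (v : Fin K)
    (ν : Finset (Fin N) → ℝ) (f : Config K N T → ℝ) : ℝ :=
  Ex PE (Function.update (fun _ => userWeight Λ π) v ν) f

/-- Sparsity constant of the law of a user. -/
noncomputable def sparsity (Λ : ℝ[X]) : ℝ := 5 * (Λ.natDegree : ℝ) ^ 3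

/-- `N` times this bounds the probability that the exploration of depth `ℓ` from a slot returns to
a given user. -/
noncomputable def cycleBound (Λ : ℝ[X]) (M : ℝ) (ℓ : ℕ) : ℝ :=
  returnBound (sparsity Λ) M Λ.natDegree ℓ 1

/-- Fraction of blocked slots. -/
noncomputable def blockedFrac {K N T : ℕ} (ω : Config K N T) (ℓ : ℕ) : ℝ :=
  ((blocked ω ℓ).card : ℝ) / N

variable {K N : ℕ} {M : ℝ}

theorem blockedFrac_nonneg (ω : Config K N T) (ℓ : ℕ) : 0 ≤ blockedFrac ω ℓ := by
  unfold blockedFrac; positivity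

theorem blockedFrac_le_one (ω : Config K N T) (ℓ : ℕ) : blockedFrac ω ℓ ≤ 1 := by
  unfold blockedFrac
  refine div_le_one_of_le₀ ?_ (by positivity)
  exact_mod_cast (Finset.card_le_univ (blocked ω ℓ)).trans_eq (by simp)

theorem sparsity_nonneg (Λ : ℝ[X]) : 0 ≤ sparsity Λ := by unfold sparsity; positivity

theorem cycleBound_nonneg (Λ : ℝ[X]) (hM : 0 ≤ M) (ℓ : ℕ) : 0 ≤ cycleBound Λ M ℓ :=
  returnBound_nonneg (sparsity_nonneg Λ) hM _ _ _

theorem mean_eq_meanWith (v : Fin K) (f : Config K N T → ℝ) :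
    mean Λ π PE f = meanWith Λ π PE v (userWeight Λ π) f := by
  unfold mean meanWith
  rw [Function.update_eq_self_iff.2 rfl]

namespace Setting

variable (S : Setting Λ π T PE)

include S

theorem userLaw (hN : 2 * Λ.natDegree ≤ N) :
    IsUserLaw Λ.natDegree (userWeight (N := N) Λ π) :=
  userWeight_isUserLaw S.degree S.active_pos.le S.active_le (by omega)

theorem sparse (hN : 2 * Λ.natDegree ≤ N) : IsSparse (sparsity Λ) (userWeight (N := N) Λ π) :=
  userWeight_isSparse S.degree S.active_pos.le S.active_le hN

theorem lawWith (hN : 2 * Λ.natDegree ≤ N) (v : Fin K) {ν : Finset (Fin N) → ℝ}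
    (hν : IsUserLaw Λ.natDegree ν) (u : Fin K) :
    IsUserLaw Λ.natDegree (Function.update (fun _ => userWeight Λ π) v ν u) :=
  update_isUserLaw (fun _ => S.userLaw hN) v hν u

theorem returns_le (hN : 2 * Λ.natDegree ≤ N) (hM : 0 ≤ M) (hK : (K : ℝ) ≤ M * N) (v : Fin K)
    {ν : Finset (Fin N) → ℝ} (hν : IsUserLaw Λ.natDegree ν) (ℓ : ℕ) (t : Fin N) :
    meanWith Λ π PE v ν (fun ω : Config K N T => ind (Returns ω ℓ t {v})) ≤
      cycleBound Λ M ℓ / N := by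
  have := Ex_returns_le (w := Function.update (fun _ => userWeight Λ π) v ν) hM
    (sparsity_nonneg Λ) S.slot (S.sparse hN) hK ℓ t {v} (S.lawWith hN v hν) fun u hu => by
      rw [Function.update_of_ne (by simpa using hu)]
  rwa [Finset.card_singleton] at this

omit S in
theorem abs_ind_sub_ind_le {p q r : Prop} (h : ¬r → (p ↔ q)) : |ind p - ind q| ≤ ind r := by
  by_cases hr : r
  · rw [ind_of hr]; exact ind_sub_ind_abs_le_one p q
  · rw [ind_congr (h hr), sub_self, abs_zero]; exact ind_nonneg r

omit S in
theorem ind_or_le (p q : Prop) : ind (p ∨ q) ≤ ind p + ind q := by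
  by_cases hp : p
  · rw [ind_of (Or.inl hp), ind_of hp]; linarith [ind_nonneg q]
  · rw [ind_of_not hp, zero_add]; exact ind_mono fun h => h.resolve_left hp

/-- Removing one user changes few blocked slots. -/
theorem blockedFrac_stable (hN : 2 * Λ.natDegree ≤ N) (hM : 0 ≤ M) (hK : (K : ℝ) ≤ M * N)
    (v : Fin K) {ν : Finset (Fin N) → ℝ} (hν : IsUserLaw Λ.natDegree ν) (ℓ : ℕ) :
    meanWith Λ π PE v ν (fun ω : Config K N T => |blockedFrac ω ℓ - blockedFrac (del {v} ω) ℓ|) ≤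
      (Λ.natDegree + cycleBound Λ M (ℓ - 1)) / N := by
  have hw := S.lawWith (K := K) hN v hν
  have hN0 : (0 : ℝ) < N := by
    have := S.degree.natDegree_pos
    exact_mod_cast (by omega : 0 < N)
  -- A slot can change status only if `v` uses it, which concerns at most `natDegree` slots, or if
  -- its exploration returns to `v`.
  have pt : ∀ ω : Config K N T, |blockedFrac ω ℓ - blockedFrac (del {v} ω) ℓ| ≤
      (1 / N : ℝ) * ∑ t, (ind (t ∈ ω.1 v) + ind (Returns ω (ℓ - 1) t {v})) := by
    intro ω
    unfold blockedFrac
    rw [← sub_div, abs_div, abs_of_pos hN0, div_eq_inv_mul, one_div, ← sum_ind_mem, ← sum_ind_mem,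
      ← Finset.sum_sub_distrib]
    refine mul_le_mul_of_nonneg_left ?_ (by positivity)
    refine (Finset.abs_sum_le_sum_abs _ _).trans (Finset.sum_le_sum fun t _ => ?_)
    refine (abs_ind_sub_ind_le (r := t ∈ ω.1 v ∨ Returns ω (ℓ - 1) t {v}) fun h => ?_).trans
      (ind_or_le _ _)
    rw [not_or] at h
    exact mem_blocked_del h.1 h.2
  refine (Ex_mono hw S.slot pt).trans ?_
  rw [Ex_const_mul, Ex_sum]
  have h1 : ∀ t, Ex PE (Function.update (fun _ => userWeight Λ π) v ν)
      (fun ω : Config K N T => ind (t ∈ ω.1 v) + ind (Returns ω (ℓ - 1) t {v})) ≤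
      ∑ A, ν A * ind (t ∈ A) + cycleBound Λ M (ℓ - 1) / N := by
    intro t
    rw [Ex_add (fun ω => ind (t ∈ ω.1 v)), Ex_user hw S.slot v (fun A => ind (t ∈ A)),
      Function.update_self]
    gcongr
    exact S.returns_le hN hM hK v hν _ t
  have h2 : ∑ t, Ex PE (Function.update (fun _ => userWeight Λ π) v ν)
      (fun ω : Config K N T => ind (t ∈ ω.1 v) + ind (Returns ω (ℓ - 1) t {v})) ≤
      Λ.natDegree + cycleBound Λ M (ℓ - 1) := by
    refine (Finset.sum_le_sum fun t _ => h1 t).trans ?_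
    rw [Finset.sum_add_distrib, Finset.sum_const, Finset.card_univ, Fintype.card_fin, nsmul_eq_mul,
      mul_div_cancel₀ _ hN0.ne']
    gcongr
    exact hν.sum_mem_le
  rw [one_div, div_eq_inv_mul]
  gcongr

/-- The contribution of one user to its slot, computed in the frame without that user. -/
theorem edge_cavity (hN : 2 * Λ.natDegree ≤ N) (hM : 0 ≤ M) (hK : (K : ℝ) ≤ M * N)
    (v : Fin K) (s : Fin N) (ℓ : ℕ) {H H' : Config K N T → ℝ} {e : ℝ} (he : 0 ≤ e)
    (hH' : ∀ ω, |H' ω| ≤ 1)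
    (hHH : ∀ A : Finset (Fin N), s ∈ A → A.card ≤ Λ.natDegree →
      meanWith Λ π PE v (dirac A) (fun ω => ind (s ∈ ω.1 v ∧ userUndetected ω ℓ v s) *
        |H ω - H' (del {v} ω)|) ≤ e / N) :
    |mean Λ π PE (fun ω => ind (s ∈ ω.1 v ∧ userUndetected ω ℓ v s) * H ω) -
      mean Λ π PE (fun ω => touchWeight Λ π s (blocked (del {v} ω) ℓ) * H' (del {v} ω))| ≤
      sparsity Λ / N * ((Λ.natDegree * cycleBound Λ M (ℓ - 1) + e) / N) := by
  set μ := userWeight (N := N) Λ π with hμdef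
  have hμ : IsUserLaw Λ.natDegree μ := S.userLaw hN
  set b := (Λ.natDegree * cycleBound Λ M (ℓ - 1) + e) / N with hb
  have hb0 : 0 ≤ b := by
    have := cycleBound_nonneg Λ hM (ℓ - 1)
    positivity
  have e1 : mean Λ π PE (fun ω => ind (s ∈ ω.1 v ∧ userUndetected ω ℓ v s) * H ω) =
      ∑ A, μ A * meanWith Λ π PE v (dirac A)
        (fun ω => ind (s ∈ ω.1 v ∧ userUndetected ω ℓ v s) * H ω) := Ex_cond v _
  -- Independence in use: `touchWeight` averages over a fresh set `A`, and by `Ex_del` the deleted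
  -- user may be given exactly that set without changing the expectation.
  have e2 : mean Λ π PE (fun ω => touchWeight Λ π s (blocked (del {v} ω) ℓ) * H' (del {v} ω)) =
      ∑ A, μ A * meanWith Λ π PE v (dirac A)
        (fun ω => ind (s ∈ A) * ind (A.erase s ⊆ blocked (del {v} ω) ℓ) * H' (del {v} ω)) := by
    have : (fun ω : Config K N T =>
        touchWeight Λ π s (blocked (del {v} ω) ℓ) * H' (del {v} ω)) =
        fun ω => ∑ A, μ A * ((fun ω' : Config K N T =>
          ind (s ∈ A) * ind (A.erase s ⊆ blocked ω' ℓ) * H' ω') (del {v} ω)) := by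
      funext ω
      unfold touchWeight
      rw [Finset.sum_mul]
      exact Finset.sum_congr rfl fun A _ => by ring
    rw [this, mean_eq_meanWith v, meanWith, Ex_sum]
    refine Finset.sum_congr rfl fun A _ => ?_
    rw [Ex_const_mul]
    by_cases hA : μ A = 0
    · simp [hA]
    · exact congrArg (μ A * ·) (Ex_del hμ (dirac_isUserLaw (hμ.card_le A hA)) v
        fun ω' : Config K N T => ind (s ∈ A) * ind (A.erase s ⊆ blocked ω' ℓ) * H' ω')
  rw [e1, e2, ← Finset.sum_sub_distrib]
  refine (Finset.abs_sum_le_sum_abs _ _).trans ?_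
  have term : ∀ A, |μ A * meanWith Λ π PE v (dirac A)
        (fun ω => ind (s ∈ ω.1 v ∧ userUndetected ω ℓ v s) * H ω) -
      μ A * meanWith Λ π PE v (dirac A)
        (fun ω => ind (s ∈ A) * ind (A.erase s ⊆ blocked (del {v} ω) ℓ) * H' (del {v} ω))| ≤
      μ A * ind (s ∈ A) * b := by
    intro A
    by_cases hA : μ A = 0
    · simp [hA]
    have hAc := hμ.card_le A hA
    have hd := dirac_isUserLaw hAc
    have hw := S.lawWith (K := K) hN v hd
    rw [← mul_sub, abs_mul, abs_of_nonneg (hμ.nonneg A), mul_assoc]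
    refine mul_le_mul_of_nonneg_left ?_ (hμ.nonneg A)
    by_cases hsA : s ∈ A
    swap
    · have z1 : meanWith Λ π PE v (dirac A)
          (fun ω : Config K N T => ind (s ∈ ω.1 v ∧ userUndetected ω ℓ v s) * H ω) =
          meanWith Λ π PE v (dirac A) (fun _ : Config K N T => 0) :=
        Ex_dirac_congr v A fun ω h => by
          rw [ind_of_not (by rw [h]; exact fun h' => hsA h'.1), zero_mul]
      rw [z1, ind_of_not hsA]
      simp [meanWith, Ex]
    rw [ind_of hsA, one_mul]
    refine (abs_Ex_sub_le hw S.slot _ _).trans ?_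
    have dom : Ex PE (Function.update (fun _ => userWeight Λ π) v (dirac A))
        (fun ω : Config K N T => |ind (s ∈ ω.1 v ∧ userUndetected ω ℓ v s) * H ω -
          1 * ind (A.erase s ⊆ blocked (del {v} ω) ℓ) * H' (del {v} ω)|) ≤
        Ex PE (Function.update (fun _ => userWeight Λ π) v (dirac A)) (fun ω : Config K N T =>
          ∑ t ∈ A.erase s, ind (Returns ω (ℓ - 1) t {v}) +
          ind (s ∈ ω.1 v ∧ userUndetected ω ℓ v s) * |H ω - H' (del {v} ω)|) := by
      refine Ex_mono_support hw S.slot fun ω hω => ?_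
      have hv : ω.1 v = A := by
        have := hω v
        rw [Function.update_self] at this
        by_contra h
        exact this (by simp [dirac, h])
      have hind : |ind (s ∈ ω.1 v ∧ userUndetected ω ℓ v s) -
          ind (A.erase s ⊆ blocked (del {v} ω) ℓ)| ≤
          ∑ t ∈ A.erase s, ind (Returns ω (ℓ - 1) t {v}) := by
        refine (abs_ind_sub_ind_le (r := ∃ t ∈ A.erase s, Returns ω (ℓ - 1) t {v})
          fun h => ?_).trans ?_
        · rw [← hv, ← userUndetected_iff_del]
          · simp [hv, hsA]
          · intro t ht hts hr
            exact h ⟨t, mem_erase.2 ⟨hts, hv ▸ ht⟩, hr⟩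
        · by_cases h : ∃ t ∈ A.erase s, Returns ω (ℓ - 1) t {v}
          · rw [ind_of h]
            obtain ⟨t, ht, hr⟩ := h
            have := Finset.single_le_sum (f := fun t => ind (Returns ω (ℓ - 1) t {v}))
              (fun _ _ => ind_nonneg _) ht
            simpa only [ind_of hr] using this
          · rw [ind_of_not h]
            exact Finset.sum_nonneg fun _ _ => ind_nonneg _
      set i := ind (s ∈ ω.1 v ∧ userUndetected ω ℓ v s)
      set i' := ind (A.erase s ⊆ blocked (del {v} ω) ℓ)
      have hi : 0 ≤ i := ind_nonneg _
      -- The indicators are exchanged first, at the cost of a return; then the test functions, whose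
      -- discrepancy counts only when `v` is pending at `s`.
      have : i * H ω - 1 * i' * H' (del {v} ω) =
        (i - i') * H' (del {v} ω) + i * (H ω - H' (del {v} ω)) := by ring
      rw [this]
      refine (abs_add_le _ _).trans ?_
      rw [abs_mul, abs_mul, abs_of_nonneg hi]
      gcongr
      exact (mul_le_of_le_one_right (abs_nonneg _) (hH' _)).trans hind
    refine dom.trans ?_
    rw [Ex_add (fun ω => ∑ t ∈ A.erase s, ind (Returns ω (ℓ - 1) t {v})), Ex_sum, hb, add_div]
    refine add_le_add ?_ (hHH A hsA hAc)
    refine (Finset.sum_le_sum fun t _ => S.returns_le hN hM hK v hd (ℓ - 1) t).trans ?_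
    rw [Finset.sum_const, nsmul_eq_mul, mul_div_assoc]
    have : (((A.erase s).card : ℕ) : ℝ) ≤ Λ.natDegree := by
      exact_mod_cast (Finset.card_le_card (Finset.erase_subset _ _)).trans hAc
    have := cycleBound_nonneg Λ hM (ℓ - 1)
    gcongr
  refine (Finset.sum_le_sum fun A _ => term A).trans ?_
  rw [← Finset.sum_mul]
  exact mul_le_mul_of_nonneg_right ((S.sparse hN).mem_le s) hb0

/-- Mean-field form of `edge_cavity`. -/
theorem edge_meanField (hN : 2 * Λ.natDegree ≤ N) (hM : 0 ≤ M) (hK : (K : ℝ) ≤ M * N)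
    (v : Fin K) (s : Fin N) (ℓ : ℕ) {H H' : Config K N T → ℝ} {e : ℝ} (he : 0 ≤ e)
    (hH' : ∀ ω, |H' ω| ≤ 1)
    (hHH : ∀ A : Finset (Fin N), s ∈ A → A.card ≤ Λ.natDegree →
      meanWith Λ π PE v (dirac A) (fun ω => ind (s ∈ ω.1 v ∧ userUndetected ω ℓ v s) *
        |H ω - H' (del {v} ω)|) ≤ e / N)
    (hst : mean Λ π PE (fun ω => |H' ω - H' (del {v} ω)|) ≤ e / N)
    {x : ℝ} (hx0 : 0 ≤ x) (hx1 : x ≤ 1) :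
    |N * mean Λ π PE (fun ω => ind (s ∈ ω.1 v ∧ userUndetected ω ℓ v s) * H ω) -
      π * (derivative Λ).eval x * mean Λ π PE H'| ≤
      sparsity Λ * ((Λ.natDegree * cycleBound Λ M (ℓ - 1) + e) / N) +
      2 * (Λ.natDegree : ℝ) ^ 3 / N +
      (Λ.natDegree : ℝ) ^ 2 * (mean Λ π PE (fun ω : Config K N T => |blockedFrac ω ℓ - x|) +
        (Λ.natDegree + cycleBound Λ M (ℓ - 1)) / N) + Λ.natDegree * (e / N) := by
  have hN0 : (0 : ℝ) < N := by
    have := S.degree.natDegree_pos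
    exact_mod_cast (by omega : 0 < N)
  have hw : ∀ u : Fin K, IsUserLaw Λ.natDegree ((fun _ => userWeight (N := N) Λ π) u) :=
    fun _ => S.userLaw hN
  have hπ0 := S.active_pos.le
  have c1 := S.edge_cavity hN hM hK v s ℓ he hH' hHH
  set F := mean Λ π PE (fun ω => ind (s ∈ ω.1 v ∧ userUndetected ω ℓ v s) * H ω)
  -- Chain of replacements: delete `v` (`F1`), replace `touchWeight` by Λ' of the blocked fraction
  -- (`F2`), replace that fraction by `x` (`F3`), and finally put `v` back into `H'`.
  set F1 := mean Λ π PE (fun ω : Config K N T =>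
    touchWeight Λ π s (blocked (del {v} ω) ℓ) * H' (del {v} ω)) with hF1
  set F2 := mean Λ π PE (fun ω : Config K N T =>
    π * (derivative Λ).eval (blockedFrac (del {v} ω) ℓ) * H' (del {v} ω)) with hF2
  set F3 := mean Λ π PE (fun ω : Config K N T => π * (derivative Λ).eval x * H' (del {v} ω)) with hF3
  have d1 : |N * F - N * F1| ≤
      sparsity Λ * ((Λ.natDegree * cycleBound Λ M (ℓ - 1) + e) / N) := by
    rw [← mul_sub, abs_mul, abs_of_pos hN0]
    refine (mul_le_mul_of_nonneg_left c1 hN0.le).trans_eq ?_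
    field_simp
  have d2 : |N * F1 - F2| ≤ 2 * (Λ.natDegree : ℝ) ^ 3 / N := by
    rw [hF1, hF2, mean, ← Ex_const_mul]
    refine (abs_Ex_sub_le hw S.slot _ _).trans (Ex_le_const hw S.slot fun ω => ?_)
    rw [← mul_assoc, ← sub_mul, abs_mul]
    exact (mul_le_of_le_one_right (abs_nonneg _) (hH' _)).trans
      (touchWeight_approx S.degree hπ0 S.active_le hN s _)
  have d3 : |F2 - F3| ≤ (Λ.natDegree : ℝ) ^ 2 *
      (mean Λ π PE (fun ω : Config K N T => |blockedFrac ω ℓ - x|) +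
        (Λ.natDegree + cycleBound Λ M (ℓ - 1)) / N) := by
    rw [hF2, hF3]
    refine (abs_Ex_sub_le hw S.slot _ _).trans ?_
    have st := S.blockedFrac_stable (K := K) hN hM hK v (S.userLaw hN) ℓ
    rw [← mean_eq_meanWith] at st
    refine le_trans ?_ (mul_le_mul_of_nonneg_left (add_le_add_right st _)
      (by positivity : 0 ≤ (Λ.natDegree : ℝ) ^ 2))
    unfold mean
    rw [← Ex_add (fun ω => |blockedFrac ω ℓ - x|), ← Ex_const_mul]
    refine Ex_mono hw S.slot fun ω => ?_
    rw [← sub_mul, ← mul_sub, abs_mul, abs_mul, abs_of_nonneg hπ0]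
    refine (mul_le_of_le_one_right (by positivity) (hH' _)).trans ?_
    refine (mul_le_of_le_one_left (abs_nonneg _) S.active_le).trans ?_
    refine (S.degree.eval_derivative_lipschitz (blockedFrac_nonneg _ _) (blockedFrac_le_one _ _)
      hx0 hx1).trans ?_
    gcongr
    have := abs_sub_le (blockedFrac (del {v} ω) ℓ) (blockedFrac ω ℓ) x
    rw [abs_sub_comm (blockedFrac (del {v} ω) ℓ) (blockedFrac ω ℓ)] at this
    linarith
  have d4 : |F3 - π * (derivative Λ).eval x * mean Λ π PE H'| ≤ Λ.natDegree * (e / N) := by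
    have hΛ0 := S.degree.eval_derivative_nonneg hx0
    have hΛ1 := S.degree.eval_derivative_le hx0 hx1
    rw [hF3, mean, Ex_const_mul, ← mul_sub, abs_mul, abs_of_nonneg (by positivity)]
    have h1 : |Ex PE (fun _ => userWeight Λ π) (fun ω => H' (del {v} ω)) - mean Λ π PE H'| ≤
        e / N := by
      refine le_trans ?_ hst
      rw [abs_sub_comm]
      exact abs_Ex_sub_le hw S.slot _ _
    have h2 : π * (derivative Λ).eval x ≤ Λ.natDegree := by
      have := S.active_le
      nlinarith
    gcongr
  have := abs_sub_le (N * F) (N * F1) (π * (derivative Λ).eval x * mean Λ π PE H')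
  have := abs_sub_le (N * F1) F2 (π * (derivative Λ).eval x * mean Λ π PE H')
  have := abs_sub_le F2 F3 (π * (derivative Λ).eval x * mean Λ π PE H')
  linarith

end Setting

end Cavity

/-! ### The Poisson law from its asymptotic recursion. -/

section Poisson

open Filter Topology

variable {I : Type} {l : Filter I}

/-- Weight of `j` under the Poisson law of parameter `lam`. -/
noncomputable def poissonWeight (lam : ℝ) (j : ℕ) : ℝ := Real.exp (-lam) * (lam ^ j / (j ! : ℝ))

/-- The asymptotic recursion `(j + 1) a_{j+1} = λ a_j` and tightness characterize the Poisson
distribution of parameter `λ`. -/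
theorem tendsto_poisson {a : I → ℕ → ℝ} {b rate : I → ℝ} {lam B : ℝ}
    (hrate : Tendsto rate l (𝓝 lam)) (ha : ∀ᶠ i in l, ∀ j, 0 ≤ a i j ∧ a i j ≤ 1)
    (hrec : ∀ j : ℕ, Tendsto (fun i => ((j : ℝ) + 1) * a i (j + 1) - rate i * a i j) l (𝓝 0))
    (htail : ∀ᶠ i in l, ∀ J : ℕ, 1 ≤ J → |b i - ∑ j ∈ range J, a i j| ≤ B / J) (j : ℕ) :
    Tendsto (fun i => a i j - b i * poissonWeight lam j) l (𝓝 0) := by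
  have h1 : ∀ j : ℕ, Tendsto (fun i => a i j - a i 0 * (lam ^ j / (j ! : ℝ))) l (𝓝 0) := by
    intro j
    induction j with
    | zero => simpa using tendsto_const_nhds
    | succ j ih =>
      have hbd : Tendsto (fun i => (rate i - lam) * a i j) l (𝓝 0) := by
        have h0 : Tendsto (fun i => rate i - lam) l (𝓝 0) := by
          simpa using hrate.sub_const lam
        refine squeeze_zero_norm' (ha.mono fun i hi => ?_) (by simpa using h0.norm)
        rw [norm_mul, Real.norm_of_nonneg (hi j).1]
        exact mul_le_of_le_one_right (norm_nonneg _) (hi j).2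
      -- `hbd` exchanges `rate` for its limit; the sum of the three errors, divided by `j + 1`, is
      -- the claim at `j + 1`.
      have := (((hrec j).add hbd).add (ih.const_mul lam)).const_mul (1 / ((j : ℝ) + 1))
      simp only [add_zero, mul_zero] at this
      refine this.congr fun i => ?_
      have hj : ((j : ℝ) + 1) ≠ 0 := by positivity
      have hf : (j ! : ℝ) ≠ 0 := by positivity
      rw [Nat.factorial_succ]
      push_cast
      field_simp
      ring
  -- Normalization: the total mass `b` fixes `a 0`. The cutoff `J` is chosen first, making the tail
  -- and the remainder of the exponential series small uniformly in `i`.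
  have h2 : Tendsto (fun i => b i - a i 0 * Real.exp lam) l (𝓝 0) := by
    rw [Metric.tendsto_nhds]
    intro ε hε
    have hexp : Tendsto (fun J => ∑ j ∈ range J, lam ^ j / (j ! : ℝ)) atTop (𝓝 (Real.exp lam)) := by
      have := (NormedSpace.expSeries_div_hasSum_exp (𝔸 := ℝ) lam).tendsto_sum_nat
      rwa [← Real.exp_eq_exp_ℝ] at this
    have hB : Tendsto (fun J : ℕ => B / (J : ℝ)) atTop (𝓝 0) :=
      tendsto_const_div_atTop_nhds_zero_nat B
    obtain ⟨J, hJ1, hJ2, hJ3⟩ := ((Metric.tendsto_nhds.1 hexp (ε / 3) (by positivity)).and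
      ((hB.eventually (gt_mem_nhds (by positivity : 0 < ε / 3))).and
        (eventually_ge_atTop 1))).exists
    have hsum : Tendsto (fun i => ∑ j ∈ range J, (a i j - a i 0 * (lam ^ j / (j ! : ℝ)))) l (𝓝 0) := by
      simpa using tendsto_finsetSum (range J) fun j _ => h1 j
    filter_upwards [htail, ha, Metric.tendsto_nhds.1 hsum (ε / 3) (by positivity)] with i hi1 hia hi2
    rw [Real.dist_eq] at hi2 hJ1 ⊢
    rw [sub_zero] at hi2 ⊢
    have hi1 := hi1 J hJ3
    set s1 := ∑ j ∈ range J, a i j with hs1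
    set s2 := ∑ j ∈ range J, lam ^ j / (j ! : ℝ) with hs2
    have e : ∑ j ∈ range J, (a i j - a i 0 * (lam ^ j / (j ! : ℝ))) = s1 - a i 0 * s2 := by
      rw [Finset.sum_sub_distrib, ← Finset.mul_sum]
    rw [e] at hi2
    have e2 : b i - a i 0 * Real.exp lam =
      (b i - s1) + (s1 - a i 0 * s2) + a i 0 * (s2 - Real.exp lam) := by ring
    rw [e2]
    have h3 : |a i 0 * (s2 - Real.exp lam)| ≤ |s2 - Real.exp lam| := by
      rw [abs_mul, abs_of_nonneg (hia 0).1]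
      exact mul_le_of_le_one_left (abs_nonneg _) (hia 0).2
    have := abs_add_le ((b i - s1) + (s1 - a i 0 * s2)) (a i 0 * (s2 - Real.exp lam))
    have := abs_add_le (b i - s1) (s1 - a i 0 * s2)
    linarith
  have h3 := (h1 j).sub (h2.mul_const (poissonWeight lam j))
  simp only [zero_mul, sub_zero] at h3
  refine h3.congr fun i => ?_
  unfold poissonWeight
  have : Real.exp lam * Real.exp (-lam) = 1 := by rw [← Real.exp_add]; simp
  linear_combination (a i 0 * (lam ^ j / (j ! : ℝ))) * this

end Poisson

/-! ### Recursion and tightness for the number of pending users of a slot. -/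

section PendingCount

variable {Λ : ℝ[X]} {π : ℝ} {T : ℕ} {PE : ℕ → ℝ} {K N : ℕ} {M : ℝ}

/-- The event that `j` users are pending in a slot with decoding capability `c`, weighted by a
test function. -/
noncomputable def pendingTest (ℓ : ℕ) (s : Fin N) (c : Fin (T + 1)) (Y : Config K N T → ℝ) (j : ℕ)
    (ω : Config K N T) : ℝ := ind (pending ω ℓ s = j ∧ ω.2 s = c) * Y ω

/-- A test function with values in `[0, 1]` that hardly depends on any single user. -/
structure IsStable (Λ : ℝ[X]) (π : ℝ) (PE : ℕ → ℝ) (e : ℝ) (Y : Config K N T → ℝ) : Prop where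
  nonneg : ∀ ω, 0 ≤ Y ω
  le_one : ∀ ω, Y ω ≤ 1
  stable : ∀ (v : Fin K) (ν : Finset (Fin N) → ℝ), IsUserLaw Λ.natDegree ν →
    meanWith Λ π PE v ν (fun ω => |Y ω - Y (del {v} ω)|) ≤ e / N

theorem abs_ind_mul_le_one {e : ℝ} {Y : Config K N T → ℝ} (hY : IsStable Λ π PE e Y) (p : Prop)
    (ω : Config K N T) : |ind p * Y ω| ≤ 1 := by
  rw [abs_of_nonneg (mul_nonneg (ind_nonneg p) (hY.nonneg ω))]
  exact mul_le_one₀ (ind_le_one p) (hY.nonneg ω) (hY.le_one ω)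

theorem abs_ind_mul_sub_le {p q : Prop} {y z : ℝ} (hy1 : y ≤ 1) (hy : 0 ≤ y) {r : Prop} (h : ¬r → (p ↔ q)) :
    |ind p * y - ind q * z| ≤ ind r + |y - z| := by
  have e : ind p * y - ind q * z = (ind p - ind q) * y + ind q * (y - z) := by ring
  rw [e]
  refine (abs_add_le _ _).trans (add_le_add ?_ ?_)
  · rw [abs_mul, abs_of_nonneg hy]
    exact (mul_le_of_le_one_right (abs_nonneg _) hy1).trans (Setting.abs_ind_sub_ind_le h)
  · rw [abs_mul, abs_of_nonneg (ind_nonneg q)]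
    exact mul_le_of_le_one_left (abs_nonneg _) (ind_le_one q)

theorem sum_ind_pending (ω : Config K N T) (ℓ : ℕ) (s : Fin N) :
    ∑ v, ind (s ∈ ω.1 v ∧ userUndetected ω ℓ v s) = (pending ω ℓ s : ℝ) := by
  classical
  unfold pending
  rw [Finset.card_filter]
  push_cast
  refine Finset.sum_congr rfl fun v _ => ?_
  by_cases h : s ∈ ω.1 v ∧ userUndetected ω ℓ v s
  · rw [ind_of h, if_pos h]
  · rw [ind_of_not h, if_neg h]

/-- Error term of the mean-field recursion for the number of pending users. -/
noncomputable def recursionError (Λ : ℝ[X]) (M : ℝ) (ℓ N : ℕ) (e δ : ℝ) : ℝ :=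
  sparsity Λ * ((Λ.natDegree * cycleBound Λ M (ℓ - 1) + (sparsity Λ + cycleBound Λ M ℓ + e)) / N) +
      2 * (Λ.natDegree : ℝ) ^ 3 / N +
      (Λ.natDegree : ℝ) ^ 2 * (δ + (Λ.natDegree + cycleBound Λ M (ℓ - 1)) / N) +
      Λ.natDegree * ((sparsity Λ + cycleBound Λ M ℓ + e) / N)

namespace Setting

variable (S : Setting Λ π T PE)

include S

/-- On `{pending = j + 1}` the factor `j + 1` is the number of pending users. Each of the `K`
resulting terms is estimated by `edge_meanField`, and deleting the distinguished user leaves `j`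
pending ones. -/
theorem pending_recursion (hN : 2 * Λ.natDegree ≤ N) (hM : 0 ≤ M) (hK : (K : ℝ) ≤ M * N)
    (s : Fin N) (ℓ : ℕ) (c : Fin (T + 1)) {Y : Config K N T → ℝ} {e : ℝ} (he : 0 ≤ e)
    (hY : IsStable Λ π PE e Y) {x : ℝ} (hx0 : 0 ≤ x) (hx1 : x ≤ 1) (j : ℕ) :
    |((j : ℝ) + 1) * mean Λ π PE (pendingTest ℓ s c Y (j + 1)) -
      π * K / N * (derivative Λ).eval x * mean Λ π PE (pendingTest ℓ s c Y j)| ≤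
      M * recursionError Λ M ℓ N e
        (mean Λ π PE (fun ω : Config K N T => |blockedFrac ω ℓ - x|)) := by
  have hN0 : (0 : ℝ) < N := by
    have := S.degree.natDegree_pos
    exact_mod_cast (by omega : 0 < N)
  set E := recursionError Λ M ℓ N e
        (mean Λ π PE (fun ω : Config K N T => |blockedFrac ω ℓ - x|)) with hE
  have hsp := sparsity_nonneg Λ
  have hcy := cycleBound_nonneg Λ hM ℓ
  have hcy' := cycleBound_nonneg Λ hM (ℓ - 1)
  have hw : ∀ u : Fin K, IsUserLaw Λ.natDegree ((fun _ => userWeight (N := N) Λ π) u) :=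
    fun _ => S.userLaw hN
  have hδ : 0 ≤ mean Λ π PE (fun ω : Config K N T => |blockedFrac ω ℓ - x|) :=
    Ex_nonneg hw S.slot fun ω => abs_nonneg _
  have hE0 : 0 ≤ E := by
    rw [hE]; unfold recursionError; positivity
  have hv : ∀ v : Fin K, |N * mean Λ π PE (fun ω =>
      ind (s ∈ ω.1 v ∧ userUndetected ω ℓ v s) * pendingTest ℓ s c Y (j + 1) ω) -
      π * (derivative Λ).eval x * mean Λ π PE (pendingTest ℓ s c Y j)| ≤ E := by
    intro v
    -- Here `H` tests `j + 1` in the full frame and `H'` tests `j`. They match after deletion of `v`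
    -- because `H` is only read on the event that `v` is pending.
    refine S.edge_meanField hN hM hK v s ℓ (by positivity) (fun ω => abs_ind_mul_le_one hY _ ω) (fun A hsA hA => ?_) ?_ hx0 hx1
    · have hd := dirac_isUserLaw hA
      have hwA := S.lawWith (K := K) hN v hd
      have h1 : meanWith Λ π PE v (dirac A) (fun ω : Config K N T =>
          ind (s ∈ ω.1 v ∧ userUndetected ω ℓ v s) *
          |pendingTest ℓ s c Y (j + 1) ω - pendingTest ℓ s c Y j (del {v} ω)|) ≤
          meanWith Λ π PE v (dirac A) (fun ω : Config K N T => ind (Returns ω ℓ s {v}) +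
            |Y ω - Y (del {v} ω)|) := by
        refine Ex_mono hwA S.slot fun ω => ?_
        by_cases h : s ∈ ω.1 v ∧ userUndetected ω ℓ v s
        · rw [ind_of h, one_mul]
          refine abs_ind_mul_sub_le (hY.le_one _) (hY.nonneg _) fun hr => ?_
          rw [pending_eq_residual h.1 h.2, residual_eq_pending_del hr]
          simp [del]
        · rw [ind_of_not h, zero_mul]
          exact add_nonneg (ind_nonneg _) (abs_nonneg _)
      refine h1.trans ?_
      unfold meanWith
      rw [Ex_add (fun ω => ind (Returns ω ℓ s {v}))]
      refine (add_le_add (S.returns_le hN hM hK v hd ℓ s) (hY.stable v _ hd)).trans ?_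
      rw [← add_div]
      gcongr
      linarith
    · have hd := S.userLaw hN
      have h1 : mean Λ π PE (fun ω : Config K N T =>
          |pendingTest ℓ s c Y j ω - pendingTest ℓ s c Y j (del {v} ω)|) ≤
          mean Λ π PE (fun ω : Config K N T => (ind (s ∈ ω.1 v) + ind (Returns ω ℓ s {v})) +
            |Y ω - Y (del {v} ω)|) := by
        refine Ex_mono hw S.slot fun ω => ?_
        refine (abs_ind_mul_sub_le (r := s ∈ ω.1 v ∨ Returns ω ℓ s {v}) (hY.le_one _)
          (hY.nonneg _) fun hr => ?_).trans
            (add_le_add_left (ind_or_le _ _) _)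
        rw [not_or] at hr
        rw [pending_del hr.1 hr.2]
        rfl
      refine h1.trans ?_
      rw [mean_eq_meanWith v, meanWith,
        Ex_add (fun ω => ind (s ∈ ω.1 v) + ind (Returns ω ℓ s {v})),
        Ex_add (fun ω => ind (s ∈ ω.1 v)),
        Ex_user (S.lawWith hN v hd) S.slot v (fun A => ind (s ∈ A)), Function.update_self]
      refine (add_le_add (add_le_add ((S.sparse hN).mem_le s) (S.returns_le hN hM hK v hd ℓ s))
        (hY.stable v _ hd)).trans_eq ?_
      rw [add_div, add_div]
  have hsum : ((j : ℝ) + 1) * mean Λ π PE (pendingTest ℓ s c Y (j + 1)) =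
      ∑ v, mean Λ π PE (fun ω =>
        ind (s ∈ ω.1 v ∧ userUndetected ω ℓ v s) * pendingTest ℓ s c Y (j + 1) ω) := by
    unfold mean
    rw [← Ex_const_mul, ← Ex_sum]
    congr 1
    funext ω
    rw [← Finset.sum_mul, sum_ind_pending]
    unfold pendingTest
    by_cases h : pending ω ℓ s = j + 1 ∧ ω.2 s = c
    · rw [h.1]; push_cast; rfl
    · rw [ind_of_not h]; simp
  have hconst : π * K / N * (derivative Λ).eval x * mean Λ π PE (pendingTest ℓ s c Y j) =
      ∑ _v : Fin K, 1 / N * (π * (derivative Λ).eval x *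
        mean Λ π PE (pendingTest ℓ s c Y j)) := by
    rw [Finset.sum_const, Finset.card_univ, Fintype.card_fin, nsmul_eq_mul]
    ring
  rw [hsum, hconst, ← Finset.sum_sub_distrib]
  refine (Finset.abs_sum_le_sum_abs _ _).trans ?_
  calc _ ≤ ∑ _v : Fin K, 1 / N * E := by
        refine Finset.sum_le_sum fun v _ => ?_
        refine le_trans (le_of_eq ?_) (mul_le_mul_of_nonneg_left (hv v) (by positivity))
        rw [← abs_of_nonneg (by positivity : (0 : ℝ) ≤ 1 / N), ← abs_mul,
          abs_of_nonneg (by positivity : (0 : ℝ) ≤ 1 / N)]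
        congr 1
        field_simp
    _ = K / N * E := by
        rw [Finset.sum_const, Finset.card_univ, Fintype.card_fin, nsmul_eq_mul]
        ring
    _ ≤ M * E := by
        have : (K : ℝ) / N ≤ M := by rwa [div_le_iff₀ hN0]
        gcongr

theorem mean_pending_le (hN : 2 * Λ.natDegree ≤ N) (hK : (K : ℝ) ≤ M * N)
    (s : Fin N) (ℓ : ℕ) :
    mean Λ π PE (fun ω : Config K N T => (pending ω ℓ s : ℝ)) ≤ M * sparsity Λ := by
  have hN0 : (0 : ℝ) < N := by
    have := S.degree.natDegree_pos
    exact_mod_cast (by omega : 0 < N)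
  have hw : ∀ u : Fin K, IsUserLaw Λ.natDegree ((fun _ => userWeight (N := N) Λ π) u) :=
    fun _ => S.userLaw hN
  have hsp := sparsity_nonneg Λ
  calc mean Λ π PE (fun ω : Config K N T => (pending ω ℓ s : ℝ))
      ≤ Ex PE (fun _ => userWeight Λ π) (fun ω : Config K N T => ∑ v, ind (s ∈ ω.1 v)) := by
        refine Ex_mono hw S.slot fun ω => ?_
        rw [← sum_ind_pending]
        exact Finset.sum_le_sum fun v _ => ind_mono fun h => h.1
    _ ≤ ∑ _v : Fin K, sparsity Λ / N := by
        rw [Ex_sum]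
        refine Finset.sum_le_sum fun v _ => ?_
        rw [Ex_user hw S.slot v (fun A => ind (s ∈ A))]
        exact (S.sparse hN).mem_le s
    _ = K * (sparsity Λ / N) := by
        rw [Finset.sum_const, Finset.card_univ, Fintype.card_fin, nsmul_eq_mul]
    _ ≤ M * N * (sparsity Λ / N) := by gcongr
    _ = M * sparsity Λ := by field_simp

/-- Markov's inequality with `mean_pending_le`; this is the tightness required by `tendsto_poisson`.
-/
theorem pending_tail (hN : 2 * Λ.natDegree ≤ N) (hK : (K : ℝ) ≤ M * N)
    (s : Fin N) (ℓ : ℕ) (c : Fin (T + 1)) {Y : Config K N T → ℝ} {e : ℝ}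
    (hY : IsStable Λ π PE e Y) {J : ℕ} (hJ : 1 ≤ J) :
    |mean Λ π PE (fun ω => ind (ω.2 s = c) * Y ω) -
      ∑ j ∈ range J, mean Λ π PE (pendingTest ℓ s c Y j)| ≤ M * sparsity Λ / J := by
  have hw : ∀ u : Fin K, IsUserLaw Λ.natDegree ((fun _ => userWeight (N := N) Λ π) u) :=
    fun _ => S.userLaw hN
  have hJ0 : (0 : ℝ) < J := by exact_mod_cast hJ
  unfold mean
  rw [← Ex_sum]
  refine (abs_Ex_sub_le hw S.slot _ _).trans ?_
  have h1 : Ex PE (fun _ => userWeight Λ π) (fun ω : Config K N T =>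
      |ind (ω.2 s = c) * Y ω - ∑ j ∈ range J, pendingTest ℓ s c Y j ω|) ≤
      Ex PE (fun _ => userWeight Λ π) (fun ω : Config K N T => 1 / J * (pending ω ℓ s : ℝ)) := by
    refine Ex_mono hw S.slot fun ω => ?_
    have hsum : ∑ j ∈ range J, pendingTest ℓ s c Y j ω =
        ind (pending ω ℓ s < J) * (ind (ω.2 s = c) * Y ω) := by
      unfold pendingTest
      by_cases h : pending ω ℓ s < J
      · rw [Finset.sum_eq_single (pending ω ℓ s), ind_and, ind_of rfl, ind_of h]
        · ring
        · intro j _ hj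
          rw [ind_of_not (fun h' => hj h'.1.symm), zero_mul]
        · intro h'
          exact absurd (Finset.mem_range.2 h) h'
      · rw [ind_of_not h, zero_mul]
        refine Finset.sum_eq_zero fun j hj => ?_
        rw [ind_of_not, zero_mul]
        rintro ⟨rfl, _⟩
        exact h (Finset.mem_range.1 hj)
    rw [hsum]
    by_cases h : pending ω ℓ s < J
    · rw [ind_of h, one_mul, sub_self, abs_zero]
      positivity
    · rw [ind_of_not h, zero_mul, sub_zero]
      refine (abs_ind_mul_le_one hY _ ω).trans ?_
      rw [one_div, ← div_eq_inv_mul, one_le_div hJ0]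
      exact_mod_cast not_lt.1 h
  refine h1.trans ?_
  rw [Ex_const_mul, one_div, ← div_eq_inv_mul]
  exact div_le_div_of_nonneg_right (S.mean_pending_le hN hK s ℓ) hJ0.le

end Setting

end PendingCount

/-! ### Independence and law of large numbers for the slot decoders. -/

section SlotCoordinates

variable {K N T : ℕ} {PE : ℕ → ℝ} {w : Fin K → Finset (Fin N) → ℝ} {D : ℕ}

theorem Ex_slots (hw : ∀ u, IsUserLaw D (w u)) (h : Fin N → Fin (T + 1) → ℝ) :
    Ex PE w (fun ω : Config K N T => ∏ s, h s (ω.2 s)) = ∏ s, ∑ c, slotWeight PE c * h s c := by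
  have := Ex_prod (PE := PE) (w := w) (T := T) (fun _ _ => 1) h
  simpa [(hw _).sum_one] using this

theorem Ex_slot (hw : ∀ u, IsUserLaw D (w u)) (hs : IsSlotLaw T PE) (s : Fin N)
    (h : Fin (T + 1) → ℝ) :
    Ex PE w (fun ω : Config K N T => h (ω.2 s)) = ∑ c, slotWeight PE c * h c := by
  have h1 := Ex_slots (PE := PE) hw (fun r c => if r = s then h c else (1 : ℝ))
  have e1 : (fun ω : Config K N T => ∏ r, if r = s then h (ω.2 r) else (1 : ℝ)) =
      fun ω => h (ω.2 s) := by
    funext ω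
    rw [Finset.prod_ite_eq' univ s (fun r => h (ω.2 r))]
    simp
  have e2 : ∀ r, ∑ c : Fin (T + 1), slotWeight PE c * (if r = s then h c else (1 : ℝ)) =
      if r = s then ∑ c, slotWeight PE c * h c else 1 := by
    intro r
    split_ifs
    · rfl
    · simpa using hs.sum_one
  rw [e1] at h1
  rw [h1, Finset.prod_congr rfl fun r _ => e2 r, Finset.prod_ite_eq']
  simp

theorem Ex_slot_mul_eq_zero (hw : ∀ u, IsUserLaw D (w u)) {r s : Fin N} (hrs : r ≠ s)
    {h : Fin (T + 1) → ℝ} (h0 : ∑ c, slotWeight PE c * h c = 0) :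
    Ex PE w (fun ω : Config K N T => h (ω.2 r) * h (ω.2 s)) = 0 := by
  have h1 := Ex_slots (PE := PE) hw (fun t c => (if t = r then h c else (1 : ℝ)) *
    (if t = s then h c else (1 : ℝ)))
  have e1 : (fun ω : Config K N T => ∏ t, (if t = r then h (ω.2 t) else (1 : ℝ)) *
      (if t = s then h (ω.2 t) else (1 : ℝ))) = fun ω => h (ω.2 r) * h (ω.2 s) := by
    funext ω
    rw [Finset.prod_mul_distrib, Finset.prod_ite_eq' univ r (fun t => h (ω.2 t)),
      Finset.prod_ite_eq' univ s (fun t => h (ω.2 t))]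
    simp
  rw [e1] at h1
  rw [h1]
  refine Finset.prod_eq_zero (Finset.mem_univ r) ?_
  simpa [hrs] using h0

/-- Weak law of large numbers for the slot decoders. -/
theorem Ex_slot_average_le (hw : ∀ u, IsUserLaw D (w u)) (hs : IsSlotLaw T PE) (hN : 0 < N)
    (c : Fin (T + 1)) :
    Ex PE w (fun ω : Config K N T =>
      |1 / (N : ℝ) * ∑ s, ind (ω.2 s = c) - slotWeight PE c|) ^ 2 ≤ 1 / N := by
  have hN0 : (0 : ℝ) < N := by exact_mod_cast hN
  -- Centred indicators: in the second moment the off-diagonal terms vanish by independence, and the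
  -- `N` diagonal ones are at most 1.
  set h : Fin (T + 1) → ℝ := fun c' => ind (c' = c) - slotWeight PE c with hh
  have hc0 := hs.nonneg c
  have hc1 : slotWeight PE c ≤ 1 := by
    rw [← hs.sum_one]
    exact Finset.single_le_sum (fun c' _ => hs.nonneg c') (Finset.mem_univ c)
  have h0 : ∑ c', slotWeight PE c' * h c' = 0 := by
    simp only [hh, mul_sub, Finset.sum_sub_distrib]
    rw [← Finset.sum_mul, hs.sum_one, Finset.sum_eq_single c]
    · rw [ind_of rfl]; ring
    · intro c' _ hc'
      rw [ind_of_not hc', mul_zero]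
    · simp
  have hle : ∀ c', h c' * h c' ≤ 1 := by
    intro c'
    have h1 := ind_nonneg (c' = c)
    have h2 := ind_le_one (c' = c)
    have : |h c'| ≤ 1 := abs_le.2 ⟨by simp only [hh]; linarith, by simp only [hh]; linarith⟩
    have := abs_le.1 this
    nlinarith
  refine (Ex_abs_sq_le hw hs _).trans ?_
  have e : (fun ω : Config K N T => (1 / (N : ℝ) * ∑ s, ind (ω.2 s = c) - slotWeight PE c) ^ 2) =
      fun ω => 1 / (N : ℝ) ^ 2 * ∑ r, ∑ s, h (ω.2 r) * h (ω.2 s) := by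
    funext ω
    have : 1 / (N : ℝ) * ∑ s, ind (ω.2 s = c) - slotWeight PE c = 1 / N * ∑ s, h (ω.2 s) := by
      simp only [hh, Finset.sum_sub_distrib, Finset.sum_const, Finset.card_univ,
        Fintype.card_fin, nsmul_eq_mul]
      field_simp
    rw [this, mul_pow, pow_two (∑ s, h (ω.2 s)), Finset.sum_mul_sum, one_div, one_div, inv_pow]
  rw [e, Ex_const_mul, Ex_sum]
  have hr : ∀ r, Ex PE w (fun ω : Config K N T => ∑ s, h (ω.2 r) * h (ω.2 s)) ≤ 1 := by
    intro r
    rw [Ex_sum, Finset.sum_eq_single r]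
    · exact Ex_le_const hw hs fun ω => hle _
    · intro s _ hsr
      exact Ex_slot_mul_eq_zero hw hsr.symm h0
    · simp
  calc _ ≤ 1 / (N : ℝ) ^ 2 * ∑ _r : Fin N, (1 : ℝ) := by
        gcongr with r
        exact hr r
    _ = 1 / N := by
        simp
        field_simp

end SlotCoordinates

/-! ### Limits of blocked slots and concentration of their fraction. -/

section Limits

open Filter Topology

variable {I : Type} {l : Filter I}

/-- A family of frames whose number of slots tends to infinity while the load tends to `G`. -/
structure IsLoadLimit (π G : ℝ) (l : Filter I) (K N : I → ℕ) : Prop where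
  slots : Tendsto N l atTop
  load : Tendsto (fun i => π * (K i : ℝ) / (N i : ℝ)) l (𝓝 G)

variable {Λ : ℝ[X]} {π G : ℝ} {T : ℕ} {PE : ℕ → ℝ} {K N : I → ℕ}

theorem IsLoadLimit.comp {J : Type} {l' : Filter J} (h : IsLoadLimit π G l K N) {f : J → I}
    (hf : Tendsto f l' l) : IsLoadLimit π G l' (fun j => K (f j)) (fun j => N (f j)) :=
  ⟨h.slots.comp hf, h.load.comp hf⟩

theorem IsLoadLimit.const_div (h : IsLoadLimit π G l K N) (a : ℝ) :
    Tendsto (fun i => a / (N i : ℝ)) l (𝓝 0) :=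
  tendsto_const_nhds.div_atTop (tendsto_natCast_atTop_atTop.comp h.slots)

theorem IsLoadLimit.exists_bound (h : IsLoadLimit π G l K N) (hπ : 0 < π) (hG : 0 < G) :
    ∃ M : ℝ, 0 ≤ M ∧ ∀ᶠ i in l, (K i : ℝ) ≤ M * N i := by
  refine ⟨(G + 1) / π, by positivity, ?_⟩
  filter_upwards [h.load.eventually (gt_mem_nhds (lt_add_one G)),
    h.slots.eventually_ge_atTop 1] with i h1 h2
  have hN0 : (0 : ℝ) < N i := by exact_mod_cast h2
  rw [div_lt_iff₀ hN0] at h1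
  rw [div_mul_eq_mul_div, le_div_iff₀ hπ]
  linarith

theorem IsLoadLimit.recursionError (h : IsLoadLimit π G l K N) {M : ℝ} (ℓ : ℕ) (e : ℝ)
    {δ : I → ℝ} (hδ : Tendsto δ l (𝓝 0)) :
    Tendsto (fun i => M * recursionError Λ M ℓ (N i) e (δ i)) l (𝓝 0) := by
  have h1 := ((((h.const_div (Λ.natDegree * cycleBound Λ M (ℓ - 1) +
    (sparsity Λ + cycleBound Λ M ℓ + e))).const_mul (sparsity Λ)).add
    (h.const_div (2 * (Λ.natDegree : ℝ) ^ 3))).add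
    ((hδ.add (h.const_div (Λ.natDegree + cycleBound Λ M (ℓ - 1)))).const_mul
      ((Λ.natDegree : ℝ) ^ 2))).add
    ((h.const_div (sparsity Λ + cycleBound Λ M ℓ + e)).const_mul (Λ.natDegree : ℝ))
  have h2 := h1.const_mul M
  simpa [IRSA.recursionError] using h2

/-- Probability that a slot fails on one packet plus a Poisson number of further packets. -/
noncomputable def slotFailure (T : ℕ) (PE : ℕ → ℝ) (lam : ℝ) : ℝ :=
  1 - ∑ c : Fin (T + 1), slotWeight PE c * ∑ j ∈ range c, poissonWeight lam j

/-- Limiting fraction of blocked slots. -/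
noncomputable def blockedLimit (Λ : ℝ[X]) (T : ℕ) (PE : ℕ → ℝ) (G : ℝ) : ℕ → ℝ
  | 0 => 1
  | ℓ + 1 => slotFailure T PE (G * (derivative Λ).eval (blockedLimit Λ T PE G ℓ))

theorem sum_poissonWeight_le_one {lam : ℝ} (h : 0 ≤ lam) (n : ℕ) :
    ∑ j ∈ range n, poissonWeight lam j ≤ 1 := by
  unfold poissonWeight
  rw [← Finset.mul_sum, Real.exp_neg, ← div_eq_inv_mul, div_le_one (Real.exp_pos _)]
  exact Real.sum_le_exp_of_nonneg h n

theorem poissonWeight_nonneg {lam : ℝ} (h : 0 ≤ lam) (j : ℕ) : 0 ≤ poissonWeight lam j := by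
  unfold poissonWeight; positivity

theorem slotFailure_mem (hs : IsSlotLaw T PE) {lam : ℝ} (h : 0 ≤ lam) :
    0 ≤ slotFailure T PE lam ∧ slotFailure T PE lam ≤ 1 := by
  have h0 : ∀ n, 0 ≤ ∑ j ∈ range n, poissonWeight lam j := fun n =>
    Finset.sum_nonneg fun j _ => poissonWeight_nonneg h j
  unfold slotFailure
  constructor
  · have : ∑ c : Fin (T + 1), slotWeight PE c * ∑ j ∈ range c, poissonWeight lam j ≤
        ∑ c : Fin (T + 1), slotWeight PE c := Finset.sum_le_sum fun c _ =>
      mul_le_of_le_one_right (hs.nonneg c) (sum_poissonWeight_le_one h c)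
    rw [hs.sum_one] at this
    linarith
  · have : 0 ≤ ∑ c : Fin (T + 1), slotWeight PE c * ∑ j ∈ range c, poissonWeight lam j :=
      Finset.sum_nonneg fun c _ => mul_nonneg (hs.nonneg c) (h0 c)
    linarith

theorem blockedLimit_mem (hΛ : IsDegreeLaw Λ) (hs : IsSlotLaw T PE) (hG : 0 ≤ G) (ℓ : ℕ) :
    0 ≤ blockedLimit Λ T PE G ℓ ∧ blockedLimit Λ T PE G ℓ ≤ 1 := by
  induction ℓ with
  | zero => simp [blockedLimit]
  | succ ℓ ih => exact slotFailure_mem hs (mul_nonneg hG (hΛ.eval_derivative_nonneg ih.1))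

/-- Complementary event: the slot can decode an additional user iff its capability `c` exceeds the
number `j` of pending users. Only finitely many pairs `(c, j)` occur, so limits may be taken term by
term. -/
theorem ind_mem_blocked_succ {K N : ℕ} (ω : Config K N T) (ℓ : ℕ) (s : Fin N)
    (Y : Config K N T → ℝ) : ind (s ∈ blocked ω (ℓ + 1)) * Y ω =
      Y ω - ∑ c : Fin (T + 1), ∑ j ∈ range c, pendingTest ℓ s c Y j ω := by
  have h1 : ∑ c : Fin (T + 1), ∑ j ∈ range c, pendingTest ℓ s c Y j ω =
      ∑ j ∈ range (ω.2 s : ℕ), ind (pending ω ℓ s = j) * Y ω := by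
    rw [Finset.sum_eq_single (ω.2 s)]
    · refine Finset.sum_congr rfl fun j _ => ?_
      unfold pendingTest
      rw [ind_and, ind_of (p := ω.2 s = ω.2 s) rfl, mul_one]
    · intro c _ hc
      refine Finset.sum_eq_zero fun j _ => ?_
      unfold pendingTest
      rw [ind_of_not (fun h => hc h.2.symm), zero_mul]
    · simp
  have h2 : s ∈ blocked ω (ℓ + 1) ↔ (ω.2 s : ℕ) < pending ω ℓ s + 1 := by simp [blocked]
  rw [h1, ind_congr h2]
  by_cases h : pending ω ℓ s < (ω.2 s : ℕ)
  · rw [ind_of_not (by omega), Finset.sum_eq_single (pending ω ℓ s)]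
    · rw [ind_of rfl]; ring
    · intro j _ hj
      rw [ind_of_not (Ne.symm hj), zero_mul]
    · intro h'
      exact absurd (Finset.mem_range.2 h) h'
  · rw [ind_of (by omega), Finset.sum_eq_zero]
    · ring
    · intro j hj
      have := Finset.mem_range.1 hj
      rw [ind_of_not (by omega), zero_mul]

/-- Convergence along `comap Sigma.fst l` is convergence uniform in the slot, and so passes to
averages. -/
theorem tendsto_average {f : ∀ i, Fin (N i) → ℝ}
    (h : Tendsto (fun p : Σ i, Fin (N i) => f p.1 p.2) (comap Sigma.fst l) (𝓝 0)) :
    Tendsto (fun i => 1 / (N i : ℝ) * ∑ s, f i s) l (𝓝 0) := by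
  rw [Metric.tendsto_nhds] at h ⊢
  intro ε hε
  have h1 := h (ε / 2) (by positivity)
  rw [eventually_comap] at h1
  filter_upwards [h1] with i hi
  rw [Real.dist_eq, sub_zero, abs_mul, abs_of_nonneg (by positivity : (0 : ℝ) ≤ 1 / N i)]
  have h2 : |∑ s, f i s| ≤ N i * (ε / 2) := by
    refine (Finset.abs_sum_le_sum_abs _ _).trans ?_
    refine (Finset.sum_le_sum fun s _ => ?_).trans_eq (b := ∑ _s : Fin (N i), ε / 2) (by simp)
    have := hi ⟨i, s⟩ rfl
    rw [Real.dist_eq, sub_zero] at this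
    exact this.le
  by_cases hN0 : N i = 0
  · have hN1 : (N i : ℝ) = 0 := by exact_mod_cast hN0
    rw [hN1]; simpa using hε
  have hN1 : (0 : ℝ) < N i := by exact_mod_cast Nat.pos_of_ne_zero hN0
  calc 1 / (N i : ℝ) * |∑ s, f i s| ≤ 1 / N i * (N i * (ε / 2)) := by gcongr
    _ = ε / 2 := by field_simp
    _ < ε := by linarith

/-- Convergence of the fraction of blocked slots to `x`, along all families of frames. -/
def Concentrates (Λ : ℝ[X]) (π G : ℝ) (T : ℕ) (PE : ℕ → ℝ) (ℓ : ℕ) (x : ℝ) : Prop :=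
  ∀ (I : Type) (l : Filter I) (K N : I → ℕ), IsLoadLimit π G l K N →
    Tendsto (fun i => mean Λ π PE (fun ω : Config (K i) (N i) T => |blockedFrac ω ℓ - x|)) l (𝓝 0)

namespace Setting

variable (S : Setting Λ π T PE)

include S

theorem mean_ind_mul_mem {K N : ℕ} (hN : 2 * Λ.natDegree ≤ N) {e : ℝ} {Y : Config K N T → ℝ}
    (hY : IsStable Λ π PE e Y) (p : Config K N T → Prop) :
    0 ≤ mean Λ π PE (fun ω => ind (p ω) * Y ω) ∧ mean Λ π PE (fun ω => ind (p ω) * Y ω) ≤ 1 :=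
  ⟨Ex_nonneg (fun _ => S.userLaw hN) S.slot fun ω => mul_nonneg (ind_nonneg _) (hY.nonneg ω),
    Ex_le_const (fun _ => S.userLaw hN) S.slot fun ω =>
      (le_abs_self _).trans (abs_ind_mul_le_one hY _ ω)⟩

/-- `tendsto_poisson` is applied for each capability `c` to the masses weighted by `Y`, whose total
is the mean of `ind (ω.2 s = c) * Y`. Keeping `c` and `Y` inside the expectation gives the
asymptotic independence that concentration needs. -/
theorem slot_limit (hG : 0 < G) {ℓ : ℕ} {x : ℝ} (hx0 : 0 ≤ x) (hx1 : x ≤ 1)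
    (hc : Concentrates Λ π G T PE ℓ x) (h : IsLoadLimit π G l K N) (s : ∀ i, Fin (N i))
    {e : ℝ} (he : 0 ≤ e) {Y : ∀ i, Config (K i) (N i) T → ℝ}
    (hY : ∀ᶠ i in l, IsStable Λ π PE e (Y i)) :
    Tendsto (fun i => mean Λ π PE (fun ω => ind (s i ∈ blocked ω (ℓ + 1)) * Y i ω) -
      (mean Λ π PE (Y i) - ∑ c : Fin (T + 1), ∑ j ∈ range c,
        mean Λ π PE (fun ω => ind (ω.2 (s i) = c) * Y i ω) *
          poissonWeight (G * (derivative Λ).eval x) j)) l (𝓝 0) := by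
  obtain ⟨M, hM, hKM⟩ := h.exists_bound S.active_pos hG
  have hND := h.slots.eventually_ge_atTop (2 * Λ.natDegree)
  have key : ∀ (c : Fin (T + 1)) (j : ℕ), Tendsto (fun i =>
      mean Λ π PE (pendingTest ℓ (s i) c (Y i) j) -
      mean Λ π PE (fun ω => ind (ω.2 (s i) = c) * Y i ω) *
        poissonWeight (G * (derivative Λ).eval x) j) l (𝓝 0) := by
    intro c j
    refine tendsto_poisson (a := fun i j => mean Λ π PE (pendingTest ℓ (s i) c (Y i) j))
      (rate := fun i => π * K i / N i * (derivative Λ).eval x) (B := M * sparsity Λ)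
      (h.load.mul_const _) ?_ ?_ ?_ j
    · filter_upwards [hY, hND] with i h1 h2 j
      exact S.mean_ind_mul_mem h2 h1 _
    · intro j
      refine squeeze_zero_norm' ?_ (h.recursionError (Λ := Λ) (M := M) ℓ e (hc I l K N h))
      filter_upwards [hY, hND, hKM] with i h1 h2 h3
      exact S.pending_recursion h2 hM h3 (s i) ℓ c he h1 hx0 hx1 j
    · filter_upwards [hY, hND, hKM] with i h1 h2 h3 J hJ
      exact S.pending_tail h2 h3 (s i) ℓ c h1 hJ
  have hsum : Tendsto (fun i => ∑ c : Fin (T + 1), ∑ j ∈ range (c : ℕ),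
      (mean Λ π PE (pendingTest ℓ (s i) c (Y i) j) -
      mean Λ π PE (fun ω => ind (ω.2 (s i) = c) * Y i ω) *
        poissonWeight (G * (derivative Λ).eval x) j)) l (𝓝 0) := by
    have := tendsto_finsetSum (univ : Finset (Fin (T + 1))) fun c _ =>
      tendsto_finsetSum (range (c : ℕ)) fun j _ => key c j
    simpa using this
  have hneg := hsum.neg
  rw [neg_zero] at hneg
  refine hneg.congr fun i => ?_
  have e1 : mean Λ π PE (fun ω => ind (s i ∈ blocked ω (ℓ + 1)) * Y i ω) =
      mean Λ π PE (Y i) - ∑ c : Fin (T + 1), ∑ j ∈ range c,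
        mean Λ π PE (pendingTest ℓ (s i) c (Y i) j) := by
    unfold mean
    simp only [ind_mem_blocked_succ]
    rw [Ex_sub (Y i), Ex_sum]
    simp only [Ex_sum]
  rw [e1]
  simp only [Finset.sum_sub_distrib]
  ring

omit S in
theorem isStable_one {K N : ℕ} : IsStable Λ π PE 0 (fun _ : Config K N T => (1 : ℝ)) where
  nonneg _ := zero_le_one
  le_one _ := le_rfl
  stable v ν _ := by simp [meanWith, Ex]

theorem isStable_blockedFrac {K N : ℕ} {M : ℝ} (hN : 2 * Λ.natDegree ≤ N) (hM : 0 ≤ M)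
    (hK : (K : ℝ) ≤ M * N) (ℓ : ℕ) :
    IsStable Λ π PE (Λ.natDegree + cycleBound Λ M (ℓ - 1))
      (fun ω : Config K N T => blockedFrac ω ℓ) where
  nonneg ω := blockedFrac_nonneg ω ℓ
  le_one ω := blockedFrac_le_one ω ℓ
  stable v _ hν := S.blockedFrac_stable hN hM hK v hν ℓ

/-- Limit of the probability that a slot is blocked. -/
theorem mean_blocked_tendsto (hG : 0 < G) {ℓ : ℕ}
    (hc : Concentrates Λ π G T PE ℓ (blockedLimit Λ T PE G ℓ)) (h : IsLoadLimit π G l K N)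
    (s : ∀ i, Fin (N i)) :
    Tendsto (fun i => mean Λ π PE (fun ω : Config (K i) (N i) T =>
      ind (s i ∈ blocked ω (ℓ + 1)))) l (𝓝 (blockedLimit Λ T PE G (ℓ + 1))) := by
  have hx := blockedLimit_mem S.degree S.slot hG.le ℓ
  have h1 := S.slot_limit hG hx.1 hx.2 hc h s le_rfl
    (Y := fun i _ => 1) (Eventually.of_forall fun i => isStable_one)
  have h2 := h1.add_const (blockedLimit Λ T PE G (ℓ + 1))
  rw [zero_add] at h2
  refine h2.congr' ?_
  filter_upwards [h.slots.eventually_ge_atTop (2 * Λ.natDegree)] with i hN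
  have hw : ∀ u : Fin (K i), IsUserLaw Λ.natDegree ((fun _ => userWeight (N := N i) Λ π) u) :=
    fun _ => S.userLaw hN
  have e1 : mean Λ π PE (fun _ : Config (K i) (N i) T => (1 : ℝ)) = 1 := Ex_one hw S.slot
  have e2 : ∀ c : Fin (T + 1), mean Λ π PE (fun ω : Config (K i) (N i) T =>
      ind (ω.2 (s i) = c) * 1) = slotWeight PE c := by
    intro c
    simp only [mul_one]
    rw [mean, Ex_slot hw S.slot (s i) (fun c' => ind (c' = c)), Finset.sum_eq_single c]
    · rw [ind_of rfl, mul_one]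
    · intro c' _ hc'
      rw [ind_of_not hc', mul_zero]
    · simp
  simp only [e1, e2, ← Finset.mul_sum]
  simp only [mul_one, blockedLimit, slotFailure]
  ring

/-- Average `slot_limit` over the slots. The capability of one slot need not be independent of `Y`,
but the empirical frequency of each capability is close to the constant `slotWeight PE c`, which
factors out. -/
theorem mean_blockedFrac_mul_tendsto (hG : 0 < G) {ℓ : ℕ}
    (hc : Concentrates Λ π G T PE ℓ (blockedLimit Λ T PE G ℓ)) (h : IsLoadLimit π G l K N)
    {e : ℝ} (he : 0 ≤ e) {Y : ∀ i, Config (K i) (N i) T → ℝ}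
    (hY : ∀ᶠ i in l, IsStable Λ π PE e (Y i)) :
    Tendsto (fun i => mean Λ π PE (fun ω => blockedFrac ω (ℓ + 1) * Y i ω) -
      blockedLimit Λ T PE G (ℓ + 1) * mean Λ π PE (Y i)) l (𝓝 0) := by
  have hx := blockedLimit_mem S.degree S.slot hG.le ℓ
  set lam := G * (derivative Λ).eval (blockedLimit Λ T PE G ℓ) with hlam
  -- The index set consists of all pairs (frame, slot), so that the limit is uniform in the slot.
  have h1 := S.slot_limit hG hx.1 hx.2 hc
    (h.comp (tendsto_comap : Tendsto (Sigma.fst : (Σ i, Fin (N i)) → I) (comap Sigma.fst l) l))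
    (fun p => p.2) he (Y := fun p => Y p.1) (tendsto_comap.eventually hY)
  have h2 := tendsto_average (f := fun i s =>
    mean Λ π PE (fun ω => ind (s ∈ blocked ω (ℓ + 1)) * Y i ω) -
      (mean Λ π PE (Y i) - ∑ c : Fin (T + 1), ∑ j ∈ range c,
        mean Λ π PE (fun ω => ind (ω.2 s = c) * Y i ω) * poissonWeight lam j)) h1
  set A : I → Fin (T + 1) → ℝ := fun i c => mean Λ π PE (fun ω : Config (K i) (N i) T =>
    (1 / (N i : ℝ) * ∑ s, ind (ω.2 s = c)) * Y i ω) with hA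
  have h3 : ∀ c, Tendsto (fun i => A i c - slotWeight PE c * mean Λ π PE (Y i)) l (𝓝 0) := by
    intro c
    have hsq : Tendsto (fun i => Real.sqrt (1 / (N i : ℝ))) l (𝓝 0) := by
      have := (Real.continuous_sqrt.tendsto 0).comp (h.const_div 1)
      rwa [Real.sqrt_zero] at this
    refine squeeze_zero_norm' ?_ hsq
    filter_upwards [hY, h.slots.eventually_ge_atTop (2 * Λ.natDegree)] with i hYi hN
    have hN0 : 0 < N i := by have := S.degree.natDegree_pos; omega
    have hw : ∀ u : Fin (K i), IsUserLaw Λ.natDegree ((fun _ => userWeight (N := N i) Λ π) u) :=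
      fun _ => S.userLaw hN
    rw [Real.norm_eq_abs]
    refine le_trans ?_ (Real.le_sqrt_of_sq_le (Ex_slot_average_le hw S.slot hN0 c))
    rw [hA]
    unfold mean
    rw [← Ex_const_mul]
    refine (abs_Ex_sub_le hw S.slot _ _).trans (Ex_mono hw S.slot fun ω => ?_)
    rw [← sub_mul, abs_mul]
    refine mul_le_of_le_one_right (abs_nonneg _) ?_
    rw [abs_of_nonneg (hYi.nonneg ω)]
    exact hYi.le_one ω
  have h4 : Tendsto (fun i => ∑ c : Fin (T + 1), (∑ j ∈ range (c : ℕ), poissonWeight lam j) *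
      (A i c - slotWeight PE c * mean Λ π PE (Y i))) l (𝓝 0) := by
    have := tendsto_finsetSum (univ : Finset (Fin (T + 1))) fun c _ =>
      (h3 c).const_mul (∑ j ∈ range (c : ℕ), poissonWeight lam j)
    simpa using this
  have h5 := h2.sub h4
  rw [sub_zero] at h5
  refine h5.congr' ?_
  filter_upwards [h.slots.eventually_ge_atTop (2 * Λ.natDegree)] with i hN
  have hN0 : (0 : ℝ) < N i := by
    have := S.degree.natDegree_pos
    exact_mod_cast (by omega : 0 < N i)
  have e1 : mean Λ π PE (fun ω => blockedFrac ω (ℓ + 1) * Y i ω) =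
      1 / (N i : ℝ) * ∑ s, mean Λ π PE (fun ω => ind (s ∈ blocked ω (ℓ + 1)) * Y i ω) := by
    unfold mean
    rw [← Ex_sum, ← Ex_const_mul]
    congr 1
    funext ω
    rw [← Finset.sum_mul, sum_ind_mem, blockedFrac]
    ring
  have e2 : ∀ c, A i c = 1 / (N i : ℝ) * ∑ s, mean Λ π PE (fun ω : Config (K i) (N i) T =>
      ind (ω.2 s = c) * Y i ω) := by
    intro c
    simp only [hA]
    unfold mean
    rw [← Ex_sum, ← Ex_const_mul]
    congr 1
    funext ω
    rw [← Finset.sum_mul]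
    ring
  have e3 : ∑ s : Fin (N i), ∑ c : Fin (T + 1), ∑ j ∈ range (c : ℕ),
      mean Λ π PE (fun ω => ind (ω.2 s = c) * Y i ω) * poissonWeight lam j =
      N i * ∑ c : Fin (T + 1), (∑ j ∈ range (c : ℕ), poissonWeight lam j) * A i c := by
    rw [Finset.sum_comm, Finset.mul_sum]
    refine Finset.sum_congr rfl fun c _ => ?_
    rw [e2]
    simp only [← Finset.mul_sum]
    rw [← Finset.sum_mul]
    field_simp
  rw [e1, Finset.sum_sub_distrib, Finset.sum_sub_distrib, e3]
  simp only [mul_sub, Finset.sum_sub_distrib, Finset.sum_const, Finset.card_univ,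
    Fintype.card_fin, nsmul_eq_mul, blockedLimit, slotFailure, ← hlam]
  have e4 : ∑ c : Fin (T + 1), (∑ j ∈ range (c : ℕ), poissonWeight lam j) *
      (slotWeight PE c * mean Λ π PE (Y i)) =
      (∑ c : Fin (T + 1), slotWeight PE c * ∑ j ∈ range (c : ℕ), poissonWeight lam j) *
        mean Λ π PE (Y i) := by
    rw [Finset.sum_mul]
    exact Finset.sum_congr rfl fun c _ => by ring
  rw [e4]
  field_simp
  ring

theorem concentrates (hG : 0 < G) (ℓ : ℕ) :
    Concentrates Λ π G T PE ℓ (blockedLimit Λ T PE G ℓ) := by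
  induction ℓ with
  | zero =>
    intro I l K N h
    refine tendsto_const_nhds.congr' ?_
    filter_upwards [h.slots.eventually_ge_atTop 1] with i hN
    have hN0 : (N i : ℝ) ≠ 0 := by
      have : N i ≠ 0 := by omega
      exact_mod_cast this
    simp [mean, Ex, blockedFrac, blocked, blockedLimit, hN0]
  | succ ℓ ih =>
    intro I l K N h
    obtain ⟨M, hM, hKM⟩ := h.exists_bound S.active_pos hG
    have hND := h.slots.eventually_ge_atTop (2 * Λ.natDegree)
    set x := blockedLimit Λ T PE G (ℓ + 1) with hx
    have h1 := S.mean_blockedFrac_mul_tendsto hG ih h le_rfl (Y := fun i _ => 1)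
      (Eventually.of_forall fun i => isStable_one)
    have h2 := S.mean_blockedFrac_mul_tendsto hG ih h
      (e := Λ.natDegree + cycleBound Λ M (ℓ + 1 - 1))
      (add_nonneg (by positivity) (cycleBound_nonneg Λ hM _))
      (Y := fun i ω => blockedFrac ω (ℓ + 1)) (by
        filter_upwards [hND, hKM] with i hN hK
        exact S.isStable_blockedFrac hN hM hK (ℓ + 1))
    -- With `X` the blocked fraction, (E[X²] - x E[X]) - x (E[X] - x) = E[(X - x)²].
    have h3 := h2.sub (h1.const_mul x)
    rw [mul_zero, sub_zero] at h3
    have h4 := (Real.continuous_sqrt.tendsto 0).comp h3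
    rw [Real.sqrt_zero] at h4
    refine squeeze_zero_norm' ?_ h4
    filter_upwards [hND] with i hN
    have hw : ∀ u : Fin (K i), IsUserLaw Λ.natDegree ((fun _ => userWeight (N := N i) Λ π) u) :=
      fun _ => S.userLaw hN
    have hnn : 0 ≤ mean Λ π PE (fun ω : Config (K i) (N i) T => |blockedFrac ω (ℓ + 1) - x|) :=
      Ex_nonneg hw S.slot fun ω => abs_nonneg _
    rw [Real.norm_of_nonneg hnn]
    refine Real.le_sqrt_of_sq_le ((Ex_abs_sq_le hw S.slot _).trans_eq ?_)
    have e1 : Ex PE (fun _ => userWeight Λ π) (fun _ : Config (K i) (N i) T => (1 : ℝ)) = 1 :=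
      Ex_one hw S.slot
    have e2 : (fun ω : Config (K i) (N i) T => (blockedFrac ω (ℓ + 1) - x) ^ 2) = fun ω =>
        (blockedFrac ω (ℓ + 1) * blockedFrac ω (ℓ + 1) - 2 * x * blockedFrac ω (ℓ + 1)) +
          x ^ 2 * 1 := by funext ω; ring
    rw [e2, Ex_add (fun ω => blockedFrac ω (ℓ + 1) * blockedFrac ω (ℓ + 1) -
      2 * x * blockedFrac ω (ℓ + 1)), Ex_sub (fun ω => blockedFrac ω (ℓ + 1) *
      blockedFrac ω (ℓ + 1)), Ex_const_mul, Ex_const_mul, e1]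
    simp only [mean, e1, mul_one]
    ring

end Setting

end Limits

/-! ### The law of the decoder capability and the closed form of the failure probability. -/

section SlotLaw

variable {T : ℕ} {PE : ℕ → ℝ}

theorem successProb_succ_self (T : ℕ) (PE : ℕ → ℝ) : successProb T PE (T + 1) = 0 := by
  simp [successProb]

theorem isSlotLaw (hPE : ∀ t ∈ Finset.Icc 1 T, 0 ≤ PE t ∧ PE t ≤ 1)
    (hmono : ∀ t, 1 ≤ t → t + 1 ≤ T → PE t ≤ PE (t + 1)) : IsSlotLaw T PE where
  nonneg c := by
    have hc := c.isLt
    unfold slotWeight successProb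
    by_cases h0 : (c : ℕ) = 0
    · by_cases hT : 1 ≤ T
      · have := hPE 1 (Finset.mem_Icc.2 ⟨le_rfl, hT⟩)
        simp [h0, hT, this.1]
      · simp [h0, hT]
    · by_cases h1 : (c : ℕ) + 1 ≤ T
      · have := hmono c (by omega) h1
        simp [h0, h1, (by omega : (c : ℕ) ≤ T), this]
      · have := hPE c (Finset.mem_Icc.2 ⟨by omega, by omega⟩)
        simp [h0, h1, (by omega : (c : ℕ) ≤ T), this.2]
  sum_one := by
    unfold slotWeight
    rw [Fin.sum_univ_eq_sum_range (fun c => successProb T PE c - successProb T PE (c + 1)),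
      Finset.sum_range_sub', successProb_succ_self]
    simp [successProb]

/-- Summation by parts. -/
theorem sum_sub_mul_sum_range (f g : ℕ → ℝ) (n : ℕ) :
    ∑ c ∈ range n, (f c - f (c + 1)) * ∑ j ∈ range c, g j =
      ∑ j ∈ range n, f (j + 1) * g j - f n * ∑ j ∈ range n, g j := by
  induction n with
  | zero => simp
  | succ n ih =>
    rw [Finset.sum_range_succ, ih, Finset.sum_range_succ, Finset.sum_range_succ g]
    ring

/-- Summation by parts trades the law of the capability for its tail `successProb`. The boundary
term vanishes because `T + 1` packets are never decoded. -/
theorem slotFailure_eq (lam : ℝ) : slotFailure T PE lam = 1 - Real.exp (-lam) *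
    ∑ t ∈ Finset.Icc 1 T, (1 - PE t) * (lam ^ (t - 1) / ((t - 1).factorial : ℝ)) := by
  unfold slotFailure slotWeight
  rw [Fin.sum_univ_eq_sum_range (fun c => (successProb T PE c - successProb T PE (c + 1)) *
    ∑ j ∈ range c, poissonWeight lam j), sum_sub_mul_sum_range,
    Finset.sum_range_succ (fun j => successProb T PE (j + 1) * poissonWeight lam j),
    successProb_succ_self, zero_mul, zero_mul, add_zero, sub_zero, Finset.mul_sum, ← Finset.Ico_add_one_right_eq_Icc,
    Finset.sum_Ico_eq_sum_range]
  simp only [Nat.add_sub_cancel]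
  refine congrArg (1 - ·) (Finset.sum_congr rfl fun j hj => ?_)
  have hj' := Finset.mem_range.1 hj
  rw [add_comm 1 j, Nat.add_sub_cancel]
  unfold poissonWeight successProb
  rw [if_neg (by omega), if_pos (by omega)]
  ring

end SlotLaw

/-! ### Conditional probabilities given an edge. -/

section EdgeProbabilities

open Filter Topology

variable {Λ : ℝ[X]} {π G : ℝ} {T : ℕ} {PE : ℕ → ℝ}

namespace Setting

variable (S : Setting Λ π T PE)

include S

theorem prob_edge {K N : ℕ} (hN : 2 * Λ.natDegree ≤ N) (u : Fin K) (s : Fin N) :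
    prob Λ π PE (fun ω : Config K N T => s ∈ ω.1 u) = π * meanDegree Λ / N := by
  rw [prob_eq_Ex, Ex_user (fun _ => S.userLaw hN) S.slot u (fun A => ind (s ∈ A)),
    sum_userWeight_mem, touchWeight_univ (by omega)]

/-- An unresolved slot-to-user message has nearly the probability of a blocked slot. -/
theorem edgeProb_slotUnresolved {K N : ℕ} {M : ℝ} (hN : 2 * Λ.natDegree ≤ N) (hM : 0 ≤ M)
    (hK : (K : ℝ) ≤ M * N) (ℓ : ℕ) (u : Fin K) (s : Fin N) :
    |edgeProb Λ π PE (fun ω : Config K N T => slotUnresolved ω ℓ s u) u s -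
      mean Λ π PE (fun ω : Config K N T => ind (s ∈ blocked ω (ℓ + 1)))| ≤
      (sparsity Λ + 2 * cycleBound Λ M ℓ) / N := by
  have hN0 : (0 : ℝ) < N := by
    have := S.degree.natDegree_pos
    exact_mod_cast (by omega : 0 < N)
  have hμ : IsUserLaw Λ.natDegree (userWeight (N := N) Λ π) := S.userLaw hN
  have hw : ∀ u : Fin K, IsUserLaw Λ.natDegree ((fun _ => userWeight (N := N) Λ π) u) :=
    fun _ => hμ
  have hπ := S.active_pos
  have hd := S.degree.meanDegree_pos
  -- Conditioning on the edge does not affect the frame without `u`, so `β` is compared with the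
  -- conditional probability on one side and the unconditional one on the other.
  set β := mean Λ π PE (fun ω : Config K N T => ind (s ∈ blocked (del {u} ω) (ℓ + 1))) with hβ
  have h1 : |edgeProb Λ π PE (fun ω : Config K N T => slotUnresolved ω ℓ s u) u s - β| ≤
      cycleBound Λ M ℓ / N := by
    have hnum : |prob Λ π PE (fun ω : Config K N T => s ∈ ω.1 u ∧ slotUnresolved ω ℓ s u) -
        π * meanDegree Λ / N * β| ≤ π * meanDegree Λ / N * (cycleBound Λ M ℓ / N) := by
      have hsum : ∑ A : Finset (Fin N), userWeight Λ π A * ind (s ∈ A) = π * meanDegree Λ / N := by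
        rw [sum_userWeight_mem, touchWeight_univ (by omega)]
      rw [prob_eq_Ex, Ex_cond u, ← hsum, Finset.sum_mul, Finset.sum_mul,
        ← Finset.sum_sub_distrib]
      refine (Finset.abs_sum_le_sum_abs _ _).trans (Finset.sum_le_sum fun A _ => ?_)
      rw [mul_assoc, mul_assoc, ← mul_sub, abs_mul, abs_of_nonneg (hμ.nonneg A)]
      by_cases hA : userWeight Λ π A = 0
      · simp [hA]
      refine mul_le_mul_of_nonneg_left ?_ (hμ.nonneg A)
      have hdA := dirac_isUserLaw (hμ.card_le A hA)
      have hwA := S.lawWith (K := K) hN u hdA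
      by_cases hsA : s ∈ A
      · rw [ind_of hsA, one_mul, one_mul]
        have hβA : β = Ex PE (Function.update (fun _ => userWeight Λ π) u (dirac A))
            (fun ω : Config K N T => ind (s ∈ blocked (del {u} ω) (ℓ + 1))) := by
          rw [hβ, mean_eq_meanWith u]
          exact Ex_del hμ hdA u (fun ω : Config K N T => ind (s ∈ blocked ω (ℓ + 1)))
        rw [hβA, Ex_dirac_congr u A (g := fun ω => ind (slotUnresolved ω ℓ s u)) fun ω h => by
          rw [ind_and, h, ind_of hsA, one_mul]]
        refine (abs_Ex_sub_le hwA S.slot _ _).trans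
          ((Ex_mono hwA S.slot fun ω => ?_).trans (S.returns_le hN hM hK u hdA ℓ s))
        exact abs_ind_sub_ind_le fun h => slotUnresolved_iff_del h
      · rw [Ex_dirac_congr u A (g := fun _ => 0) fun ω h => ind_of_not fun h' => hsA (h ▸ h'.1),
          ind_of_not hsA]
        simp [Ex]
    have hp : 0 < π * meanDegree Λ / N := by positivity
    unfold edgeProb
    rw [S.prob_edge hN, ← mul_le_mul_iff_right₀ hp]
    refine le_trans (le_of_eq ?_) hnum
    rw [← abs_of_pos hp, ← abs_mul, abs_of_pos hp]
    congr 1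
    field_simp
  have h2 : |β - mean Λ π PE (fun ω : Config K N T => ind (s ∈ blocked ω (ℓ + 1)))| ≤
      (sparsity Λ + cycleBound Λ M ℓ) / N := by
    rw [abs_sub_comm]
    refine (abs_Ex_sub_le hw S.slot _ _).trans ?_
    have : Ex PE (fun _ => userWeight Λ π) (fun ω : Config K N T =>
        |ind (s ∈ blocked ω (ℓ + 1)) - ind (s ∈ blocked (del {u} ω) (ℓ + 1))|) ≤
        mean Λ π PE (fun ω : Config K N T => ind (s ∈ ω.1 u) + ind (Returns ω ℓ s {u})) := by
      refine Ex_mono hw S.slot fun ω => ?_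
      refine (abs_ind_sub_ind_le (r := s ∈ ω.1 u ∨ Returns ω ℓ s {u}) fun h => ?_).trans
        (ind_or_le _ _)
      rw [not_or] at h
      exact mem_blocked_del h.1 h.2
    refine this.trans ?_
    rw [mean_eq_meanWith u, meanWith, Ex_add (fun ω => ind (s ∈ ω.1 u)),
      Ex_user (S.lawWith hN u hμ) S.slot u (fun A => ind (s ∈ A)), Function.update_self, add_div]
    exact add_le_add ((S.sparse hN).mem_le s) (S.returns_le hN hM hK u hμ ℓ s)
  refine (abs_sub_le _ β _).trans ((add_le_add h1 h2).trans_eq ?_)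
  rw [← add_div]
  ring

variable {I : Type} {l : Filter I} {K N : I → ℕ}

theorem edgeProb_slotUnresolved_tendsto (hG : 0 < G) (h : IsLoadLimit π G l K N) (ℓ : ℕ)
    (u : ∀ i, Fin (K i)) (s : ∀ i, Fin (N i)) :
    Tendsto (fun i => edgeProb Λ π PE
      (fun ω : Config (K i) (N i) T => slotUnresolved ω ℓ (s i) (u i)) (u i) (s i)) l
      (𝓝 (blockedLimit Λ T PE G (ℓ + 1))) := by
  obtain ⟨M, hM, hKM⟩ := h.exists_bound S.active_pos hG
  have h1 := S.mean_blocked_tendsto hG (S.concentrates hG ℓ) h s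
  have h2 : Tendsto (fun i => edgeProb Λ π PE
      (fun ω : Config (K i) (N i) T => slotUnresolved ω ℓ (s i) (u i)) (u i) (s i) -
      mean Λ π PE (fun ω : Config (K i) (N i) T => ind (s i ∈ blocked ω (ℓ + 1)))) l (𝓝 0) := by
    refine squeeze_zero_norm' ?_ (h.const_div (sparsity Λ + 2 * cycleBound Λ M ℓ))
    filter_upwards [h.slots.eventually_ge_atTop (2 * Λ.natDegree), hKM] with i hN hK
    exact S.edgeProb_slotUnresolved hN hM hK ℓ (u i) (s i)
  simpa using h2.add h1

theorem edgeProb_userUndetected_tendsto (hG : 0 < G) (h : IsLoadLimit π G l K N) (ℓ : ℕ)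
    (u : ∀ i, Fin (K i)) (s : ∀ i, Fin (N i)) :
    Tendsto (fun i => edgeProb Λ π PE
      (fun ω : Config (K i) (N i) T => userUndetected ω ℓ (u i) (s i)) (u i) (s i)) l
      (𝓝 ((derivative Λ).eval (blockedLimit Λ T PE G ℓ) / meanDegree Λ)) := by
  obtain ⟨M, hM, hKM⟩ := h.exists_bound S.active_pos hG
  have hπ := S.active_pos
  have hd := S.degree.meanDegree_pos
  have hx := blockedLimit_mem S.degree S.slot hG.le ℓ
  set x := blockedLimit Λ T PE G ℓ
  have h2 : Tendsto (fun i => N i * mean Λ π PE (fun ω : Config (K i) (N i) T =>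
      ind (s i ∈ ω.1 (u i) ∧ userUndetected ω ℓ (u i) (s i)) * 1) -
      π * (derivative Λ).eval x * mean Λ π PE (fun _ : Config (K i) (N i) T => 1)) l (𝓝 0) := by
    have hlim := (((h.const_div (Λ.natDegree * cycleBound Λ M (ℓ - 1) + 0)).const_mul
      (sparsity Λ)).add (h.const_div (2 * (Λ.natDegree : ℝ) ^ 3))).add
      (((S.concentrates hG ℓ I l K N h).add
        (h.const_div (Λ.natDegree + cycleBound Λ M (ℓ - 1)))).const_mul
        ((Λ.natDegree : ℝ) ^ 2)) |>.add ((h.const_div 0).const_mul (Λ.natDegree : ℝ))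
    simp only [mul_zero, add_zero] at hlim
    refine squeeze_zero_norm' ?_ hlim
    filter_upwards [h.slots.eventually_ge_atTop (2 * Λ.natDegree), hKM] with i hN hK
    -- With constant test functions the mean-field estimate bears on the joint probability of the
    -- edge and the message, and `e = 0`.
    refine (S.edge_meanField hN hM hK (u i) (s i) ℓ (H := fun _ => 1) (H' := fun _ => 1) le_rfl
      (fun _ => by simp) (fun A _ _ => by simp [meanWith, Ex]) (by simp [mean, Ex])
      hx.1 hx.2).trans_eq ?_
    simp [x]
  have h3 := (h2.const_mul (1 / (π * meanDegree Λ))).add_const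
    ((derivative Λ).eval x / meanDegree Λ)
  rw [mul_zero, zero_add] at h3
  refine h3.congr' ?_
  filter_upwards [h.slots.eventually_ge_atTop (2 * Λ.natDegree)] with i hN
  have hN0 : (0 : ℝ) < N i := by
    have := S.degree.natDegree_pos
    exact_mod_cast (by omega : 0 < N i)
  have e1 : mean Λ π PE (fun _ : Config (K i) (N i) T => (1 : ℝ)) = 1 :=
    Ex_one (fun _ => S.userLaw hN) S.slot
  rw [e1]
  unfold edgeProb
  rw [S.prob_edge hN, prob_eq_Ex]
  simp only [mul_one, mean]
  field_simp
  ring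

end Setting

/-- Convergence for all choices of edges is uniform convergence. -/
theorem eventually_forall_edge {K N : ℕ → ℕ} (hKN : IsLoadLimit π G atTop K N)
    {f : ∀ j, Fin (K j) → Fin (N j) → ℝ} {a : ℝ}
    (h : ∀ (I : Type) (l : Filter I) (idx : I → ℕ) (u : ∀ i, Fin (K (idx i))) (s : ∀ i, Fin (N (idx i))),
      IsLoadLimit π G l (fun i => K (idx i)) (fun i => N (idx i)) →
      Tendsto (fun i => f (idx i) (u i) (s i)) l (𝓝 a)) :
    ∀ ε > 0, ∀ᶠ j in atTop, ∀ (u : Fin (K j)) (s : Fin (N j)), |f j u s - a| < ε := by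
  intro ε hε
  -- All candidate edges of all frames form the index set; convergence along the pulled-back filter
  -- is uniformity over edges.
  have h1 := h (Σ j, Fin (K j) × Fin (N j)) (comap Sigma.fst atTop) Sigma.fst
    (fun p => p.2.1) (fun p => p.2.2) (hKN.comp tendsto_comap)
  have h2 := Metric.tendsto_nhds.1 h1 ε hε
  rw [eventually_comap] at h2
  filter_upwards [h2] with j hj u s
  exact hj ⟨j, u, s⟩ rfl

end EdgeProbabilities

end IRSA

/-! ### Assembly of the density evolution recursion. -/

theorem theorem1
    (Λ : Polynomial ℝ) (hΛ_nonneg : ∀ d, 0 ≤ Λ.coeff d) (hΛ_zero : Λ.coeff 0 = 0)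
    (hΛ_one : Λ.eval 1 = 1)
    (T : ℕ) (PE : ℕ → ℝ)
    (hPE_mem : ∀ t ∈ Finset.Icc 1 T, 0 ≤ PE t ∧ PE t ≤ 1)
    (hPE_mono : ∀ t, 1 ≤ t → t + 1 ≤ T → PE t ≤ PE (t + 1))
    (π G : ℝ) (hπ_pos : 0 < π) (hπ_le : π ≤ 1) (hG : 0 < G)
    (K N : ℕ → ℕ) (hN : Filter.Tendsto N Filter.atTop Filter.atTop)
    (hload : Filter.Tendsto (fun j => π * (K j : ℝ) / (N j : ℝ)) Filter.atTop (nhds G)) :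
    ∃ p q : ℕ → ℝ,
      -- the edge probabilities at every iteration converge, uniformly over all edges
      (∀ ℓ : ℕ, ∀ ε > 0, ∀ᶠ j in Filter.atTop, ∀ (u : Fin (K j)) (s : Fin (N j)),
        |IRSA.edgeProb Λ π PE
          (fun ω : IRSA.Config (K j) (N j) T => IRSA.slotUnresolved ω ℓ s u) u s - p ℓ| < ε) ∧
      (∀ ℓ : ℕ, ∀ ε > 0, ∀ᶠ j in Filter.atTop, ∀ (u : Fin (K j)) (s : Fin (N j)),
        |IRSA.edgeProb Λ π PE
          (fun ω : IRSA.Config (K j) (N j) T => IRSA.userUndetected ω ℓ u s) u s - q ℓ| < ε) ∧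
      -- starting point
      q 0 = 1 ∧
      p 0 = 1 - Real.exp (-(G * IRSA.meanDegree Λ)) *
        ∑ t ∈ Finset.Icc 1 T,
          (1 - PE t) * ((G * IRSA.meanDegree Λ) ^ (t - 1) / ((t - 1).factorial : ℝ)) ∧
      -- recursion
      (∀ ℓ : ℕ, 1 ≤ ℓ →
        p ℓ = 1 - Real.exp (-(G * IRSA.meanDegree Λ * q ℓ)) *
          ∑ t ∈ Finset.Icc 1 T,
            (1 - PE t) * ((G * IRSA.meanDegree Λ * q ℓ) ^ (t - 1) / ((t - 1).factorial : ℝ)) ∧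
        q ℓ = 1 / IRSA.meanDegree Λ *
          ∑ d ∈ Finset.Icc 1 Λ.natDegree, Λ.coeff d * (d : ℝ) * p (ℓ - 1) ^ (d - 1) ∧
        q ℓ = (Polynomial.derivative Λ).eval (p (ℓ - 1)) / IRSA.meanDegree Λ) ∧
      -- the case without multi-packet reception
      (T = 1 →
        p 0 = 1 - (1 - PE 1) * Real.exp (-(G * IRSA.meanDegree Λ)) ∧
        ∀ ℓ : ℕ, 1 ≤ ℓ →
          p ℓ = 1 - (1 - PE 1) * Real.exp (-(G * IRSA.meanDegree Λ * q ℓ))) := by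
  have S : IRSA.Setting Λ π T PE :=
    ⟨⟨hΛ_nonneg, hΛ_zero, hΛ_one⟩, hπ_pos, hπ_le, IRSA.isSlotLaw hPE_mem hPE_mono⟩
  have hKN : IRSA.IsLoadLimit π G Filter.atTop K N := ⟨hN, hload⟩
  have hd := S.degree.meanDegree_pos
  set x := IRSA.blockedLimit Λ T PE G with hx
  set q : ℕ → ℝ := fun ℓ => (Polynomial.derivative Λ).eval (x ℓ) / IRSA.meanDegree Λ with hq
  have hrate : ∀ ℓ, G * IRSA.meanDegree Λ * q ℓ = G * (Polynomial.derivative Λ).eval (x ℓ) := by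
    intro ℓ
    simp only [hq]
    field_simp
  have hq0 : q 0 = 1 := div_self hd.ne'
  have hp : ∀ ℓ, x (ℓ + 1) = 1 - Real.exp (-(G * IRSA.meanDegree Λ * q ℓ)) *
      ∑ t ∈ Finset.Icc 1 T,
        (1 - PE t) * ((G * IRSA.meanDegree Λ * q ℓ) ^ (t - 1) / ((t - 1).factorial : ℝ)) := by
    intro ℓ
    rw [hrate]
    exact IRSA.slotFailure_eq _
  have hp0 := hp 0
  rw [hq0, mul_one] at hp0
  -- Index shift: `x ℓ` describes the slots as read by the users at iteration `ℓ`, that is, slot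
  -- messages of iteration `ℓ - 1`. Hence `p ℓ = x (ℓ + 1)`, while `x 0 = 1` gives `q 0 = 1`.
  refine ⟨fun ℓ => x (ℓ + 1), q, fun ℓ => ?_, fun ℓ => ?_, hq0, hp0, fun ℓ hℓ => ⟨hp ℓ, ?_, ?_⟩,
    fun hT => ⟨?_, fun ℓ _ => ?_⟩⟩
  · exact IRSA.eventually_forall_edge hKN fun I l idx u s h =>
      S.edgeProb_slotUnresolved_tendsto hG h ℓ u s
  · exact IRSA.eventually_forall_edge hKN fun I l idx u s h =>
      S.edgeProb_userUndetected_tendsto hG h ℓ u s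
  · simp only [hq, Nat.sub_add_cancel hℓ]
    rw [IRSA.eval_derivative_eq, ← Finset.Ico_add_one_right_eq_Icc, Finset.sum_Ico_eq_sum_range,
      div_eq_inv_mul, one_div]
    congr 1
    refine Finset.sum_congr (by simp) fun d _ => ?_
    rw [add_comm 1 d, Nat.add_sub_cancel]
    push_cast
    ring
  · simp only [hq, Nat.sub_add_cancel hℓ]
  · subst hT
    simp only [zero_add] at hp0 ⊢
    rw [hp0]
    simp
    ring
  · subst hT
    simp only [hp ℓ]
    simp
    ring
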